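/- Let $c>0$ and let $\mathbb{Z}_+=\{0,1,2,\dots\}$. Let $X=(X_n)_{n\ge 0}$ be a once-reinforced random walk on $\mathbb{Z}_+$ with parameter $c$ started at $X_0=0$; that is, $X$ is a $\mathbb{Z}_+$-valued process adapted to a filtration $(\mathcal F_n)_{n\ge0}$ such that, with $R_n:=\max\{X_0,X_1,\dots,X_n\}$, for every $n\ge 0$ almost surely $$ \mathbf P(X_{n+1}=X_n+1\mid\mathcal F_n)=1-\mathbf P(X_{n+1}=X_n-1\mid\mathcal F_n)= \begin{cases} 1 & \text{if } X_n=0,\\ \tfrac12 & \text{if } 0<X_n<R_n,\\ \tfrac1{1+c} & \text{if } X_n=R_n>0. \end{cases} $$ (So $R_n+1$ is the number of distinct sites visited by time $n$.) Write $a_n\sim b_n$ if $a_n/b_n\to 1$ as $n\to\infty$. Then, for every integer $\ell\ge 1$, the moments and the integral below are finite, and $$ \mathbf E\left[\left(\frac{R_n}{\sqrt n}\right)^{\ell}\right]\sim \frac{1}{2^{(\ell-2)/2}\,\Gamma(\ell/2)}\,J_\ell(c), \qquad J_\ell(c):=2^{c}\int_0^\infty x^{\ell-1}\left(\frac{e^x}{e^{2x}+1}\right)^{c}dx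 . $$ In particular, $$ \mathbf E\left[\frac{R_n}{\sqrt n}\right]\sim\sqrt{\frac2\pi}\,J_1(c) \qquad\text{and}\qquad \mathbf E\left[\frac{R_n^2}{n}\right]\sim J_2(c). $$ -/

import Mathlib

open MeasureTheory Filter Topology

/-- The running maximum `R_n = max {X_0, X_1, …, X_n}` of a process on the non-negative integers. -/
def runningMax {Ω : Type*} (X : ℕ → Ω → ℕ) (n : ℕ) (ω : Ω) : ℕ :=
  (Finset.range (n + 1)).sup (fun k => X k ω)

/-- The probability that a once-reinforced random walk with parameter `c`, now at `x` and with
running maximum `r`, steps to `x + 1`. -/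
noncomputable def stepUpProb (c : ℝ) (x r : ℕ) : ℝ :=
  if x = 0 then 1 else if x < r then 1 / 2 else 1 / (1 + c)

/-- `X` is a once-reinforced random walk on the non-negative integers with parameter `c`, started
at `0`, with respect to the filtration `ℱ`: it is adapted, and given `ℱ n` it steps up by one with
probability `stepUpProb c (X n) (R n)` and down by one with the complementary probability.
The event `X (n + 1) = X n - 1` is written `X (n + 1) + 1 = X n` to avoid truncated subtraction. -/
structure IsOnceReinforcedWalk {Ω : Type*} {mΩ : MeasurableSpace Ω} (P : Measure Ω)
    (ℱ : Filtration ℕ mΩ) (c : ℝ) (X : ℕ → Ω → ℕ) : Prop where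
  adapted : Adapted ℱ X
  start : ∀ᵐ ω ∂P, X 0 ω = 0
  up : ∀ n, P[{ω | X (n + 1) ω = X n ω + 1}.indicator (fun _ => (1 : ℝ)) | ℱ n]
    =ᵐ[P] fun ω => stepUpProb c (X n ω) (runningMax X n ω)
  down : ∀ n, P[{ω | X (n + 1) ω + 1 = X n ω}.indicator (fun _ => (1 : ℝ)) | ℱ n]
    =ᵐ[P] fun ω => 1 - stepUpProb c (X n ω) (runningMax X n ω)

/-- The integrand `x^{ℓ-1} (e^x / (e^{2x} + 1))^c`, used only for `ℓ ≥ 1`. -/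
noncomputable def momentIntegrand (c : ℝ) (ℓ : ℕ) (x : ℝ) : ℝ :=
  x ^ (ℓ - 1) * (Real.exp x / (Real.exp (2 * x) + 1)) ^ c

/-- `J_ℓ(c) = 2^c ∫_0^∞ x^{ℓ-1} (e^x / (e^{2x} + 1))^c dx`. -/
noncomputable def momentConst (c : ℝ) (ℓ : ℕ) : ℝ :=
  (2 : ℝ) ^ c * ∫ x in Set.Ioi (0 : ℝ), momentIntegrand c ℓ x

/-- `a_n ∼ b_n`, meaning `a_n / b_n → 1` as `n → ∞`. -/
def AsympEquiv (a b : ℕ → ℝ) : Prop :=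
  Tendsto (fun n => a n / b n) atTop (𝓝 1)

/-! The proof computes the law of `R_n` at a geometric time exactly, rescales it, and then undoes
the geometric averaging by a Tauberian theorem.

With discount `s = 1 / cosh θ`, the function `cosh (θ x)` is an eigenfunction of the simple walk
reflected at `0`. Dividing by `cosh (θ r)` and multiplying by suitable factors indexed by the sites
from `r` to `m - 1` extends this to the pair (position, maximum) (`hittingPotential_step`). The
discounted martingale this produces gives the hitting time `T_m` of `m` the transform `E[s^{T_m}] =
∏_{k<m} (cosh θ + c sinh θ tanh (θ k))⁻¹`. Since `T_m ≤ n` means `m ≤ R_n`, this product equals `∑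
(1 - s) s^n P(m ≤ R_n)` (`hasSum_tail_runningMax`).

Each factor is `1 + c θ tanh (θ k) + O(θ²)` before inversion, so for `m ≈ x / θ` the product tends
to `exp (-c ∫_0^x tanh) = (cosh x)^{-c}`. An exponential bound uniform in `θ` lets this pass under
`∫ x^{p-1} dx`; the layer-cake formula then gives `∑ (1 - s) s^n E[R_n^p] ∼ p θ^{-p} ∫ x^{p-1} (cosh
x)^{-c} dx`.

Put `s = e^{-t}`, so that `t = log (cosh θ) ∼ θ² / 2`. The moments `E[R_n^p]` are monotone in `n`,
and Karamata's theorem (`tendsto_div_rpow_of_tendsto_laplace`) turns this asymptotic as `t → 0` into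
`E[R_n^p] ∼ const * n^{p/2}` (`tendsto_moment`). -/

/-! ### Karamata's Tauberian theorem for monotone sequences -/

section Karamata

open Set

/-- The Laplace sum of `a` against the test function `ψ`, at scale `t` and order `α`. -/
noncomputable def laplaceSum (a : ℕ → ℝ) (α : ℝ) (ψ : ℝ → ℝ) (t : ℝ) : ℝ :=
  t ^ α * ∑' n : ℕ, a n * Real.exp (-(t * n)) * ψ (Real.exp (-(t * n)))

/-- The Gamma integral of order `α` against the test function `ψ`. -/
noncomputable def gammaFunctional (α : ℝ) (ψ : ℝ → ℝ) : ℝ :=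
  ∫ y in Ioi (0 : ℝ), y ^ (α - 1) * Real.exp (-y) * ψ (Real.exp (-y))

lemma exp_neg_mem_Icc {y : ℝ} (hy : 0 ≤ y) : Real.exp (-y) ∈ Icc (0 : ℝ) 1 :=
  ⟨(Real.exp_pos _).le, Real.exp_le_one_iff.2 (by linarith)⟩

lemma exists_abs_le_of_continuous {ψ : ℝ → ℝ} (hψ : Continuous ψ) :
    ∃ C, ∀ z ∈ Icc (0 : ℝ) 1, |ψ z| ≤ C := by
  obtain ⟨C, hC⟩ := isCompact_Icc.exists_bound_of_continuousOn (s := Icc (0 : ℝ) 1)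
    hψ.continuousOn
  exact ⟨C, hC⟩

lemma integrableOn_gammaFunctional {α : ℝ} (hα : 0 < α) {ψ : ℝ → ℝ} (hψ : Continuous ψ) :
    IntegrableOn (fun y => y ^ (α - 1) * Real.exp (-y) * ψ (Real.exp (-y))) (Ioi 0) := by
  obtain ⟨C, hC⟩ := exists_abs_le_of_continuous hψ
  have h := Real.GammaIntegral_convergent hα
  refine Integrable.mul_bdd (c := C) (h.congr_fun (fun _ _ => mul_comm _ _) measurableSet_Ioi)
    (by fun_prop) ?_
  filter_upwards [ae_restrict_mem measurableSet_Ioi] with y hy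
  exact hC _ (exp_neg_mem_Icc (le_of_lt hy))

lemma summable_laplaceSum {a : ℕ → ℝ} (ha : ∀ n, 0 ≤ a n) {t : ℝ} (ht : 0 ≤ t)
    (hs : Summable fun n : ℕ => a n * Real.exp (-(t * n))) {ψ : ℝ → ℝ} (hψ : Continuous ψ) :
    Summable fun n : ℕ => a n * Real.exp (-(t * n)) * ψ (Real.exp (-(t * n))) := by
  obtain ⟨C, hC⟩ := exists_abs_le_of_continuous hψ
  refine Summable.of_norm_bounded (hs.mul_right C) fun n => ?_
  have h0 : 0 ≤ a n * Real.exp (-(t * n)) := mul_nonneg (ha n) (Real.exp_pos _).le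
  rw [norm_mul, Real.norm_of_nonneg h0]
  exact mul_le_mul_of_nonneg_left (hC _ (exp_neg_mem_Icc (by positivity))) h0

lemma gammaFunctional_nonneg {α : ℝ} {ψ : ℝ → ℝ} (hψ : ∀ z, 0 ≤ ψ z) :
    0 ≤ gammaFunctional α ψ :=
  setIntegral_nonneg measurableSet_Ioi fun _ hy =>
    mul_nonneg (mul_nonneg (Real.rpow_nonneg (le_of_lt hy) _) (Real.exp_pos _).le) (hψ _)

lemma abs_gammaFunctional_sub_le {α : ℝ} (hα : 0 < α) {ψ φ : ℝ → ℝ} (hψ : Continuous ψ)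
    (hφ : Continuous φ) {ε : ℝ} (h : ∀ z ∈ Icc (0 : ℝ) 1, |ψ z - φ z| ≤ ε) :
    |gammaFunctional α ψ - gammaFunctional α φ| ≤ ε * gammaFunctional α fun _ => 1 := by
  unfold gammaFunctional
  rw [← integral_sub (integrableOn_gammaFunctional hα hψ) (integrableOn_gammaFunctional hα hφ),
    ← integral_const_mul, ← Real.norm_eq_abs]
  refine norm_integral_le_of_norm_le
    ((integrableOn_gammaFunctional hα continuous_const).const_mul ε) ?_
  filter_upwards [ae_restrict_mem measurableSet_Ioi] with y hy
  have h0 : 0 ≤ y ^ (α - 1) * Real.exp (-y) :=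
    mul_nonneg (Real.rpow_nonneg (le_of_lt hy) _) (Real.exp_pos _).le
  rw [← mul_sub, norm_mul, Real.norm_of_nonneg h0, mul_one, mul_comm ε]
  exact mul_le_mul_of_nonneg_left (h _ (exp_neg_mem_Icc (le_of_lt hy))) h0

lemma abs_laplaceSum_sub_le {a : ℕ → ℝ} (ha : ∀ n, 0 ≤ a n) (α : ℝ) {t : ℝ} (ht : 0 ≤ t)
    (hs : Summable fun n : ℕ => a n * Real.exp (-(t * n))) {ψ φ : ℝ → ℝ} (hψ : Continuous ψ)
    (hφ : Continuous φ) {ε : ℝ} (h : ∀ z ∈ Icc (0 : ℝ) 1, |ψ z - φ z| ≤ ε) :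
    |laplaceSum a α ψ t - laplaceSum a α φ t| ≤ ε * laplaceSum a α (fun _ => 1) t := by
  unfold laplaceSum
  rw [← mul_sub, ← (summable_laplaceSum ha ht hs hψ).tsum_sub (summable_laplaceSum ha ht hs hφ),
    abs_mul, abs_of_nonneg (Real.rpow_nonneg ht α), mul_left_comm, ← tsum_mul_left]
  refine mul_le_mul_of_nonneg_left ?_ (Real.rpow_nonneg ht α)
  rw [← Real.norm_eq_abs]
  refine tsum_of_norm_bounded
    ((summable_laplaceSum ha ht hs continuous_const).mul_left ε).hasSum fun n => ?_
  have h0 : 0 ≤ a n * Real.exp (-(t * n)) := mul_nonneg (ha n) (Real.exp_pos _).le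
  rw [← mul_sub, norm_mul, Real.norm_of_nonneg h0, mul_one, mul_comm ε]
  exact mul_le_mul_of_nonneg_left (h _ (exp_neg_mem_Icc (by positivity))) h0

lemma gammaFunctional_pow {α : ℝ} (hα : 0 < α) (k : ℕ) :
    gammaFunctional α (fun z => z ^ k) = (1 / ((k : ℝ) + 1)) ^ α * Real.Gamma α := by
  rw [← Real.integral_rpow_mul_exp_neg_mul_Ioi hα (by positivity)]
  refine setIntegral_congr_fun measurableSet_Ioi fun y _ => ?_
  simp only [mul_assoc, ← Real.exp_nat_mul, ← Real.exp_add]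
  ring_nf

/-- Inserting the monomial `z^k` at `z = e^{-tn}` replaces `t` by `(k + 1) t`, so the hypothesis
applies at the rescaled argument; linearity does the rest. -/
lemma tendsto_laplaceSum_polynomial {a : ℕ → ℝ} (ha : ∀ n, 0 ≤ a n) {α : ℝ} (hα : 0 < α) {L : ℝ}
    (hs : ∀ t > 0, Summable fun n : ℕ => a n * Real.exp (-(t * n)))
    (h : Tendsto (fun t : ℝ => t ^ α * ∑' n : ℕ, a n * Real.exp (-(t * n))) (𝓝[>] 0)
      (𝓝 (L * Real.Gamma α))) (p : Polynomial ℝ) :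
    Tendsto (laplaceSum a α p.eval) (𝓝[>] 0) (𝓝 (L * gammaFunctional α p.eval)) := by
  induction p using Polynomial.induction_on' with
  | add p q hp hq =>
    have e : gammaFunctional α (p + q).eval
        = gammaFunctional α p.eval + gammaFunctional α q.eval := by
      unfold gammaFunctional
      rw [← integral_add (integrableOn_gammaFunctional hα p.continuous)
        (integrableOn_gammaFunctional hα q.continuous)]
      simp only [Polynomial.eval_add, mul_add]
    rw [e, mul_add]
    refine (hp.add hq).congr' ?_
    filter_upwards [self_mem_nhdsWithin] with t ht
    unfold laplaceSum
    rw [← mul_add, ← (summable_laplaceSum ha (le_of_lt ht) (hs t ht) p.continuous).tsum_add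
      (summable_laplaceSum ha (le_of_lt ht) (hs t ht) q.continuous)]
    simp only [Polynomial.eval_add, mul_add]
  | monomial k b =>
    have e : gammaFunctional α (Polynomial.monomial k b).eval
        = b * gammaFunctional α (fun z => z ^ k) := by
      unfold gammaFunctional
      rw [← integral_const_mul]
      simp only [Polynomial.eval_monomial]
      congr 1; ext y; ring
    have hk : (0 : ℝ) < (k : ℝ) + 1 := by positivity
    have hscale : Tendsto (fun t : ℝ => ((k : ℝ) + 1) * t) (𝓝[>] 0) (𝓝[>] 0) := by
      refine tendsto_nhdsWithin_iff.2 ⟨?_, ?_⟩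
      · have : Tendsto (fun t : ℝ => ((k : ℝ) + 1) * t) (𝓝 0) (𝓝 (((k : ℝ) + 1) * 0)) :=
          (continuous_const.mul continuous_id).tendsto 0
        rw [mul_zero] at this
        exact this.mono_left nhdsWithin_le_nhds
      · filter_upwards [self_mem_nhdsWithin] with t ht using mul_pos hk ht
    have h2 := (h.comp hscale).const_mul (b * (1 / ((k : ℝ) + 1)) ^ α)
    rw [e, gammaFunctional_pow hα, show L * (b * ((1 / ((k : ℝ) + 1)) ^ α * Real.Gamma α))
      = b * (1 / ((k : ℝ) + 1)) ^ α * (L * Real.Gamma α) by ring]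
    refine h2.congr' ?_
    filter_upwards [self_mem_nhdsWithin] with t ht
    have ht0 : (0 : ℝ) < t := ht
    simp only [Function.comp, laplaceSum, Polynomial.eval_monomial]
    rw [Real.mul_rpow hk.le ht0.le, Real.div_rpow zero_le_one hk.le, Real.one_rpow]
    have hne : ((k : ℝ) + 1) ^ α ≠ 0 := (Real.rpow_pos_of_pos hk α).ne'
    field_simp
    rw [← tsum_mul_left]
    refine tsum_congr fun n => ?_
    rw [← Real.exp_nat_mul, show -(((k : ℝ) + 1) * t * (n : ℝ)) = -(t * n) + k * (-(t * n)) by ring,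
      Real.exp_add]
    ring

/-- Weierstrass approximation on `[0, 1]`: both functionals are positive, so a uniform error in the
test function costs at most that error times their total masses. -/
lemma tendsto_laplaceSum {a : ℕ → ℝ} (ha : ∀ n, 0 ≤ a n) {α : ℝ} (hα : 0 < α) {L : ℝ}
    (hs : ∀ t > 0, Summable fun n : ℕ => a n * Real.exp (-(t * n)))
    (h : Tendsto (fun t : ℝ => t ^ α * ∑' n : ℕ, a n * Real.exp (-(t * n))) (𝓝[>] 0)
      (𝓝 (L * Real.Gamma α))) {ψ : ℝ → ℝ} (hψ : Continuous ψ) :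
    Tendsto (laplaceSum a α ψ) (𝓝[>] 0) (𝓝 (L * gammaFunctional α ψ)) := by
  set G := gammaFunctional α fun _ => 1
  have hG : 0 ≤ G := gammaFunctional_nonneg fun _ => zero_le_one
  have h1 : Tendsto (laplaceSum a α fun _ => 1) (𝓝[>] 0) (𝓝 (L * G)) := by
    simpa using tendsto_laplaceSum_polynomial ha hα hs h 1
  rw [Metric.tendsto_nhds]
  intro ε hε
  have hden : 0 < |L * G| + 1 + |L| * G + 1 := by positivity
  -- The denominator collects the eventual bound `|L * G| + 1` on the Laplace mass and the limit
  -- mass `|L| * G`; the last `1` is slack.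
  set δ := ε / 2 / (|L * G| + 1 + |L| * G + 1) with hδ_def
  have hδ : 0 < δ := by positivity
  obtain ⟨p, hp⟩ := exists_polynomial_near_of_continuousOn 0 1 ψ hψ.continuousOn δ hδ
  have hp' : ∀ z ∈ Icc (0 : ℝ) 1, |ψ z - p.eval z| ≤ δ := fun z hz => by
    rw [abs_sub_comm]; exact (hp z hz).le
  have hG2 := abs_gammaFunctional_sub_le hα hψ p.continuous hp'
  have hpoly := Metric.tendsto_nhds.1 (tendsto_laplaceSum_polynomial ha hα hs h p) (ε / 2)
    (by positivity)
  have hone := h1.eventually (gt_mem_nhds (lt_of_le_of_lt (le_abs_self (L * G)) (lt_add_one _)))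
  filter_upwards [self_mem_nhdsWithin, hpoly, hone] with t ht hpt hot
  have hS := abs_laplaceSum_sub_le ha α (le_of_lt ht) (hs t ht) hψ p.continuous hp'
  rw [Real.dist_eq] at hpt ⊢
  have e1 : |L * gammaFunctional α p.eval - L * gammaFunctional α ψ| ≤ |L| * (δ * G) := by
    rw [← mul_sub, abs_mul, abs_sub_comm]
    exact mul_le_mul_of_nonneg_left hG2 (abs_nonneg _)
  have e2 : δ * laplaceSum a α (fun _ => 1) t ≤ δ * (|L * G| + 1) :=
    mul_le_mul_of_nonneg_left hot.le hδ.le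
  have e3 : δ * (|L * G| + 1 + |L| * G + 1) = ε / 2 := div_mul_cancel₀ _ hden.ne'
  calc |laplaceSum a α ψ t - L * gammaFunctional α ψ|
      ≤ |laplaceSum a α ψ t - laplaceSum a α p.eval t|
        + |laplaceSum a α p.eval t - L * gammaFunctional α p.eval|
        + |L * gammaFunctional α p.eval - L * gammaFunctional α ψ| := by
          refine (abs_sub_le _ (laplaceSum a α p.eval t) _).trans ?_
          rw [add_assoc]
          gcongr
          exact abs_sub_le _ _ _
    _ < ε := by nlinarith

/-- A continuous bump that is positive on `(x, y)` and vanishes elsewhere. -/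
noncomputable def quadraticBump (x y z : ℝ) : ℝ := max 0 ((z - x) * (y - z))

lemma continuous_quadraticBump (x y : ℝ) : Continuous (quadraticBump x y) := by
  unfold quadraticBump; fun_prop

lemma quadraticBump_nonneg (x y z : ℝ) : 0 ≤ quadraticBump x y z := le_max_left _ _

lemma mem_Ioo_of_quadraticBump_ne_zero {b d y : ℝ} (hbd : b < d)
    (h : quadraticBump (Real.exp (-d)) (Real.exp (-b)) (Real.exp (-y)) ≠ 0) : y ∈ Ioo b d := by
  have h0 : 0 < (Real.exp (-y) - Real.exp (-d)) * (Real.exp (-b) - Real.exp (-y)) := by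
    by_contra hc
    exact h (max_eq_left (not_lt.1 hc))
  have hlt : Real.exp (-d) < Real.exp (-b) := Real.exp_lt_exp.2 (by linarith)
  rcases pos_and_pos_or_neg_and_neg_of_mul_pos h0 with ⟨h1, h2⟩ | ⟨h1, h2⟩
  · have h1' := Real.exp_lt_exp.1 (sub_pos.1 h1)
    have h2' := Real.exp_lt_exp.1 (sub_pos.1 h2)
    constructor <;> linarith
  · linarith

lemma gammaFunctional_one_quadraticBump_pos {b d : ℝ} (hb : 0 ≤ b) (hbd : b < d) :
    0 < gammaFunctional 1 (quadraticBump (Real.exp (-d)) (Real.exp (-b))) := by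
  unfold gammaFunctional
  rw [integral_pos_iff_support_of_nonneg_ae]
  · have hsub : Ioo b d ⊆ Function.support (fun y : ℝ => y ^ ((1 : ℝ) - 1) * Real.exp (-y)
        * quadraticBump (Real.exp (-d)) (Real.exp (-b)) (Real.exp (-y))) ∩ Ioi 0 := by
      rintro y ⟨h1, h2⟩
      refine ⟨?_, lt_of_le_of_lt hb h1⟩
      have e1 : Real.exp (-d) < Real.exp (-y) := Real.exp_lt_exp.2 (by linarith)
      have e2 : Real.exp (-y) < Real.exp (-b) := Real.exp_lt_exp.2 (by linarith)
      have : 0 < quadraticBump (Real.exp (-d)) (Real.exp (-b)) (Real.exp (-y)) :=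
        lt_max_of_lt_right (mul_pos (by linarith) (by linarith))
      simp [this.ne']
    rw [Measure.restrict_apply' measurableSet_Ioi]
    refine lt_of_lt_of_le ?_ (measure_mono hsub)
    simpa using hbd
  · filter_upwards [ae_restrict_mem measurableSet_Ioi] with y hy
    exact mul_nonneg (mul_nonneg (Real.rpow_nonneg (le_of_lt hy) _) (Real.exp_pos _).le)
      (quadraticBump_nonneg _ _ _)
  · exact integrableOn_gammaFunctional one_pos (continuous_quadraticBump _ _)

/-- The bump lives on `b < y < d`, where `y ^ ρ` lies between `b ^ ρ` and `d ^ ρ`; this and the next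
lemma are the two sides of that sandwich. -/
lemma gammaFunctional_quadraticBump_le {ρ b d : ℝ} (hρ : 0 ≤ ρ) (hbd : b < d) :
    gammaFunctional (ρ + 1) (quadraticBump (Real.exp (-d)) (Real.exp (-b)))
      ≤ d ^ ρ * gammaFunctional 1 (quadraticBump (Real.exp (-d)) (Real.exp (-b))) := by
  unfold gammaFunctional
  rw [← integral_const_mul]
  refine setIntegral_mono_on
    (integrableOn_gammaFunctional (by linarith) (continuous_quadraticBump _ _))
    ((integrableOn_gammaFunctional one_pos (continuous_quadraticBump _ _)).const_mul _)
    measurableSet_Ioi fun y hy => ?_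
  by_cases h : quadraticBump (Real.exp (-d)) (Real.exp (-b)) (Real.exp (-y)) = 0
  · simp [h]
  · have hm := mem_Ioo_of_quadraticBump_ne_zero hbd h
    rw [sub_self, Real.rpow_zero, one_mul, mul_assoc, add_sub_cancel_right]
    exact mul_le_mul_of_nonneg_right (Real.rpow_le_rpow (le_of_lt hy) hm.2.le hρ)
      (mul_nonneg (Real.exp_pos _).le (quadraticBump_nonneg _ _ _))

lemma le_gammaFunctional_quadraticBump {ρ b d : ℝ} (hρ : 0 ≤ ρ) (hb : 0 ≤ b) (hbd : b < d) :
    b ^ ρ * gammaFunctional 1 (quadraticBump (Real.exp (-d)) (Real.exp (-b)))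
      ≤ gammaFunctional (ρ + 1) (quadraticBump (Real.exp (-d)) (Real.exp (-b))) := by
  unfold gammaFunctional
  rw [← integral_const_mul]
  refine setIntegral_mono_on
    ((integrableOn_gammaFunctional one_pos (continuous_quadraticBump _ _)).const_mul _)
    (integrableOn_gammaFunctional (by linarith) (continuous_quadraticBump _ _))
    measurableSet_Ioi fun y hy => ?_
  by_cases h : quadraticBump (Real.exp (-d)) (Real.exp (-b)) (Real.exp (-y)) = 0
  · simp [h]
  · have hm := mem_Ioo_of_quadraticBump_ne_zero hbd h
    rw [sub_self, Real.rpow_zero, one_mul, mul_assoc, add_sub_cancel_right]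
    exact mul_le_mul_of_nonneg_right (Real.rpow_le_rpow hb hm.1.le hρ)
      (mul_nonneg (Real.exp_pos _).le (quadraticBump_nonneg _ _ _))

lemma summable_exp_neg_mul_nat {t : ℝ} (ht : 0 < t) :
    Summable fun n : ℕ => Real.exp (-(t * n)) := by
  have := summable_geometric_of_lt_one (Real.exp_pos (-t)).le (Real.exp_lt_one_iff.2 (by linarith))
  refine this.congr fun n => ?_
  rw [← Real.exp_nat_mul]; ring_nf

/-- The constant sequence `1` satisfies the Tauberian hypothesis at order `1`: the expression is `t
/ (1 - e^{-t})`, an inverse slope of `1 - e^{-t}` at `0`. -/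
lemma tendsto_mul_tsum_exp_neg :
    Tendsto (fun t : ℝ => t ^ (1 : ℝ) * ∑' n : ℕ, (1 : ℝ) * Real.exp (-(t * n))) (𝓝[>] 0)
      (𝓝 (1 * Real.Gamma 1)) := by
  have h1 : HasDerivAt (fun t : ℝ => 1 - Real.exp (-t)) 1 0 := by
    have := ((Real.hasDerivAt_exp (-0)).comp (0 : ℝ) (hasDerivAt_neg 0)).const_sub 1
    simpa using this
  have h2 := (hasDerivAt_iff_tendsto_slope.1 h1).mono_left
    (nhdsWithin_mono (0 : ℝ) (show Ioi (0 : ℝ) ⊆ {0}ᶜ from fun x hx => (ne_of_gt hx)))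
  have h3 := h2.inv₀ one_ne_zero
  rw [Real.Gamma_one, mul_one]
  rw [inv_one] at h3
  refine h3.congr' ?_
  filter_upwards [self_mem_nhdsWithin] with t ht
  have ht0 : (0 : ℝ) < t := ht
  have e : ∀ n : ℕ, (1 : ℝ) * Real.exp (-(t * n)) = Real.exp (-t) ^ n := fun n => by
    rw [← Real.exp_nat_mul]; ring_nf
  rw [tsum_congr e, tsum_geometric_of_lt_one (Real.exp_pos (-t)).le
    (Real.exp_lt_one_iff.2 (by linarith)), Real.rpow_one, slope_def_field]
  simp [div_eq_mul_inv, mul_comm]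

lemma rpow_mul_laplaceSum_one_le {a : ℕ → ℝ} (ha : ∀ n, 0 ≤ a n) {t C : ℝ} (ht : 0 < t) {ψ : ℝ → ℝ}
    (hψ : Continuous ψ) (hψ0 : ∀ z, 0 ≤ ψ z) {ρ : ℝ}
    (hs : Summable fun n : ℕ => a n * Real.exp (-(t * n)))
    (h : ∀ n : ℕ, ψ (Real.exp (-(t * n))) ≠ 0 → C ≤ a n) :
    t ^ ρ * C * laplaceSum (fun _ => 1) 1 ψ t ≤ laplaceSum a (ρ + 1) ψ t := by
  unfold laplaceSum
  rw [Real.rpow_add ht, Real.rpow_one, show ∀ S : ℝ, t ^ ρ * C * (t * S) = t ^ ρ * t * (C * S)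
    from fun S => by ring, ← tsum_mul_left (a := C)]
  refine mul_le_mul_of_nonneg_left ?_ (by positivity)
  have hs1 : Summable fun n : ℕ => (1 : ℝ) * Real.exp (-(t * n)) := by
    simpa using summable_exp_neg_mul_nat ht
  refine Summable.tsum_le_tsum (fun n => ?_)
    ((summable_laplaceSum (fun _ => zero_le_one (α := ℝ)) ht.le hs1 hψ).mul_left C)
    (summable_laplaceSum ha ht.le hs hψ)
  by_cases h0 : ψ (Real.exp (-(t * n))) = 0
  · simp [h0]
  · rw [one_mul, ← mul_assoc]
    exact mul_le_mul_of_nonneg_right (mul_le_mul_of_nonneg_right (h n h0) (Real.exp_pos _).le)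
      (hψ0 _)

lemma laplaceSum_le_rpow_mul {a : ℕ → ℝ} (ha : ∀ n, 0 ≤ a n) {t C : ℝ} (ht : 0 < t) {ψ : ℝ → ℝ}
    (hψ : Continuous ψ) (hψ0 : ∀ z, 0 ≤ ψ z) {ρ : ℝ}
    (hs : Summable fun n : ℕ => a n * Real.exp (-(t * n)))
    (h : ∀ n : ℕ, ψ (Real.exp (-(t * n))) ≠ 0 → a n ≤ C) :
    laplaceSum a (ρ + 1) ψ t ≤ t ^ ρ * C * laplaceSum (fun _ => 1) 1 ψ t := by
  unfold laplaceSum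
  rw [Real.rpow_add ht, Real.rpow_one, show ∀ S : ℝ, t ^ ρ * C * (t * S) = t ^ ρ * t * (C * S)
    from fun S => by ring, ← tsum_mul_left (a := C)]
  refine mul_le_mul_of_nonneg_left ?_ (by positivity)
  have hs1 : Summable fun n : ℕ => (1 : ℝ) * Real.exp (-(t * n)) := by
    simpa using summable_exp_neg_mul_nat ht
  refine Summable.tsum_le_tsum (fun n => ?_) (summable_laplaceSum ha ht.le hs hψ)
    ((summable_laplaceSum (fun _ => zero_le_one (α := ℝ)) ht.le hs1 hψ).mul_left C)
  by_cases h0 : ψ (Real.exp (-(t * n))) = 0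
  · simp [h0]
  · rw [one_mul, ← mul_assoc]
    exact mul_le_mul_of_nonneg_right (mul_le_mul_of_nonneg_right (h n h0) (Real.exp_pos _).le)
      (hψ0 _)

/-- **Karamata's Tauberian theorem** for nonnegative monotone sequences: the Abel means of order
`ρ` determine the growth of the sequence. -/
theorem tendsto_div_rpow_of_tendsto_laplace {a : ℕ → ℝ} (ha : ∀ n, 0 ≤ a n) (hmono : Monotone a)
    {ρ L : ℝ} (hρ : 0 ≤ ρ) (hL : 0 ≤ L)
    (hs : ∀ t > 0, Summable fun n : ℕ => a n * Real.exp (-(t * n)))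
    (h : Tendsto (fun t : ℝ => t ^ (ρ + 1) * ∑' n : ℕ, a n * Real.exp (-(t * n))) (𝓝[>] 0)
      (𝓝 (L * Real.Gamma (ρ + 1)))) :
    Tendsto (fun n : ℕ => a n / (n : ℝ) ^ ρ) atTop (𝓝 L) := by
  have hinv : Tendsto (fun n : ℕ => ((n : ℝ))⁻¹) atTop (𝓝[>] 0) :=
    tendsto_inv_atTop_nhdsGT_zero.comp tendsto_natCast_atTop_atTop
  have hs1 : ∀ t > 0, Summable fun n : ℕ => (1 : ℝ) * Real.exp (-(t * n)) := fun t ht => by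
    simpa using summable_exp_neg_mul_nat ht
  -- The ratio is a weighted average of `n ^ (-ρ) * a k` over `k` in `(b n, d n)`. Its limit `q` is
  -- squeezed between `L * b ^ ρ` and `L * d ^ ρ`.
  have key : ∀ b d : ℝ, 0 ≤ b → b < d → ∃ q : ℝ, L * b ^ ρ ≤ q ∧ q ≤ L * d ^ ρ ∧
      Tendsto (fun n : ℕ => laplaceSum a (ρ + 1) (quadraticBump (Real.exp (-d)) (Real.exp (-b)))
        ((n : ℝ)⁻¹) / laplaceSum (fun _ => 1) 1
          (quadraticBump (Real.exp (-d)) (Real.exp (-b))) ((n : ℝ)⁻¹)) atTop (𝓝 q) ∧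
      ∀ᶠ n : ℕ in atTop, 0 < laplaceSum (fun _ => 1) 1
          (quadraticBump (Real.exp (-d)) (Real.exp (-b))) ((n : ℝ)⁻¹) := by
    intro b d hb hbd
    set ψ := quadraticBump (Real.exp (-d)) (Real.exp (-b))
    have hψ : Continuous ψ := continuous_quadraticBump _ _
    have hu : 0 < gammaFunctional 1 ψ := gammaFunctional_one_quadraticBump_pos hb hbd
    have h1 := (tendsto_laplaceSum ha (by linarith : 0 < ρ + 1) hs h hψ).comp hinv
    have h2 := (tendsto_laplaceSum (fun _ => zero_le_one (α := ℝ)) one_pos hs1 tendsto_mul_tsum_exp_neg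
      hψ).comp hinv
    rw [one_mul] at h2
    refine ⟨L * gammaFunctional (ρ + 1) ψ / gammaFunctional 1 ψ, ?_, ?_, h1.div h2 hu.ne',
      h2.eventually (lt_mem_nhds hu)⟩
    · rw [le_div_iff₀ hu, mul_assoc]
      exact mul_le_mul_of_nonneg_left (le_gammaFunctional_quadraticBump hρ hb hbd) hL
    · rw [div_le_iff₀ hu, mul_assoc]
      exact mul_le_mul_of_nonneg_left (gammaFunctional_quadraticBump_le hρ hbd) hL
  have hscale : ∀ n : ℕ, ((n : ℝ)⁻¹) ^ ρ * a n = a n / (n : ℝ) ^ ρ := fun n => by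
    rw [Real.inv_rpow (Nat.cast_nonneg n), div_eq_inv_mul]
  have hcont : Tendsto (fun x : ℝ => L * x ^ ρ) (𝓝 1) (𝓝 L) := by
    have : ContinuousAt (fun x : ℝ => L * x ^ ρ) 1 :=
      (Real.continuousAt_rpow_const 1 ρ (Or.inl one_ne_zero)).const_mul L
    simpa [ContinuousAt] using this
  rw [tendsto_order]
  constructor
  · intro y hy
    obtain ⟨b, hb, hb0, hb1⟩ : ∃ b, y < L * b ^ ρ ∧ 0 < b ∧ b < 1 := by
      have e1 := (hcont.eventually (lt_mem_nhds hy)).filter_mono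
        (nhdsWithin_le_nhds (s := Iio (1 : ℝ)))
      have e2 := (Ioo_mem_nhdsLT (zero_lt_one (α := ℝ)))
      obtain ⟨b, h1, h2⟩ := (e1.and e2).exists
      exact ⟨b, h1, h2⟩
    -- On the window `(b n, n)` monotonicity gives `a k ≤ a n`, so the average bounds `a n` from
    -- below. The upper bound uses the window `(n, d n)`.
    obtain ⟨q, hq, -, hlim, hpos⟩ := key b 1 hb0.le hb1
    filter_upwards [hlim.eventually (lt_mem_nhds (hb.trans_le hq)), hpos,
      eventually_gt_atTop 0] with n h1 h2 hn
    have hn' : (0 : ℝ) < n := Nat.cast_pos.2 hn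
    rw [← hscale]
    refine h1.trans_le ((div_le_iff₀ h2).2 (laplaceSum_le_rpow_mul ha (inv_pos.2 hn')
      (continuous_quadraticBump _ _) (quadraticBump_nonneg _ _) (hs _ (inv_pos.2 hn')) ?_))
    intro k hk
    have := (mem_Ioo_of_quadraticBump_ne_zero hb1 hk).2
    rw [inv_mul_eq_div, div_lt_one hn'] at this
    exact hmono (by exact_mod_cast this.le)
  · intro y hy
    obtain ⟨d, hd, hd1⟩ : ∃ d, L * d ^ ρ < y ∧ 1 < d := by
      have e1 := (hcont.eventually (gt_mem_nhds hy)).filter_mono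
        (nhdsWithin_le_nhds (s := Ioi (1 : ℝ)))
      obtain ⟨d, h1, h2⟩ := (e1.and self_mem_nhdsWithin).exists
      exact ⟨d, h1, h2⟩
    obtain ⟨q, -, hq, hlim, hpos⟩ := key 1 d zero_le_one hd1
    filter_upwards [hlim.eventually (gt_mem_nhds (hq.trans_lt hd)), hpos,
      eventually_gt_atTop 0] with n h1 h2 hn
    have hn' : (0 : ℝ) < n := Nat.cast_pos.2 hn
    rw [← hscale]
    refine lt_of_le_of_lt ((le_div_iff₀ h2).2 (rpow_mul_laplaceSum_one_le ha (inv_pos.2 hn')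
      (continuous_quadraticBump _ _) (quadraticBump_nonneg _ _) (hs _ (inv_pos.2 hn')) ?_)) h1
    intro k hk
    have := (mem_Ioo_of_quadraticBump_ne_zero hd1 hk).1
    rw [inv_mul_eq_div, one_lt_div hn'] at this
    exact hmono (by exact_mod_cast this.le)

end Karamata

/-! ### The hitting time transform of the walk -/

/-- The reciprocal of the factor that the walk picks up, at discount `1 / cosh θ`, between its
first visits to `k` and to `k + 1`. -/
noncomputable def hittingFactor (c θ : ℝ) (k : ℕ) : ℝ :=
  Real.cosh θ + c * Real.sinh θ * Real.tanh (θ * k)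

/-- The expected discount `E[(cosh θ)^{-T_m}]` at the hitting time `T_m` of `m`. -/
noncomputable def hittingTransform (c θ : ℝ) (m : ℕ) : ℝ :=
  ∏ k ∈ Finset.range m, (hittingFactor c θ k)⁻¹

/-- The expected discount at the hitting time of `m`, seen from position `x` and maximum `r`. -/
noncomputable def hittingPotential (c θ : ℝ) (m x r : ℕ) : ℝ :=
  if m ≤ r then 1 else
    Real.cosh (θ * x) / Real.cosh (θ * r) * ∏ k ∈ Finset.Ico r m, (hittingFactor c θ k)⁻¹

lemma tanh_nonneg_of_nonneg {x : ℝ} (hx : 0 ≤ x) : 0 ≤ Real.tanh x := by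
  rw [Real.tanh_eq_sinh_div_cosh]
  exact div_nonneg (Real.sinh_nonneg_iff.2 hx) (Real.cosh_pos x).le

section Potential

variable {c θ : ℝ}

lemma one_le_hittingFactor (hc : 0 ≤ c) (hθ : 0 ≤ θ) (k : ℕ) : 1 ≤ hittingFactor c θ k := by
  have h1 := Real.one_le_cosh θ
  have h2 := mul_nonneg (mul_nonneg hc (Real.sinh_nonneg_iff.2 hθ))
    (tanh_nonneg_of_nonneg (mul_nonneg hθ (Nat.cast_nonneg k)))
  unfold hittingFactor
  linarith

lemma hittingFactor_pos (hc : 0 ≤ c) (hθ : 0 ≤ θ) (k : ℕ) : 0 < hittingFactor c θ k :=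
  one_pos.trans_le (one_le_hittingFactor hc hθ k)

lemma prod_inv_hittingFactor_mem (hc : 0 ≤ c) (hθ : 0 ≤ θ) (s : Finset ℕ) :
    ∏ k ∈ s, (hittingFactor c θ k)⁻¹ ∈ Set.Icc (0 : ℝ) 1 :=
  ⟨Finset.prod_nonneg fun k _ => (inv_pos.2 (hittingFactor_pos hc hθ k)).le,
    Finset.prod_le_one (fun k _ => (inv_pos.2 (hittingFactor_pos hc hθ k)).le)
      fun k _ => inv_le_one_of_one_le₀ (one_le_hittingFactor hc hθ k)⟩

lemma hittingPotential_mem (hc : 0 ≤ c) (hθ : 0 ≤ θ) (m : ℕ) {x r : ℕ} (h : x ≤ r) :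
    hittingPotential c θ m x r ∈ Set.Icc (0 : ℝ) 1 := by
  unfold hittingPotential
  split_ifs
  · simp
  · have hp := prod_inv_hittingFactor_mem hc hθ (Finset.Ico r m)
    have h1 : Real.cosh (θ * x) / Real.cosh (θ * r) ≤ 1 := by
      rw [div_le_one (Real.cosh_pos _), Real.cosh_le_cosh, abs_of_nonneg (by positivity),
        abs_of_nonneg (by positivity)]
      gcongr
    have h0 : 0 ≤ Real.cosh (θ * x) / Real.cosh (θ * r) :=
      div_nonneg (Real.cosh_pos _).le (Real.cosh_pos _).le
    exact ⟨mul_nonneg h0 hp.1, mul_le_one₀ h1 hp.1 hp.2⟩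

lemma hittingPotential_self (m r : ℕ) :
    hittingPotential c θ m r r = ∏ k ∈ Finset.Ico r m, (hittingFactor c θ k)⁻¹ := by
  unfold hittingPotential
  split_ifs with h
  · rw [Finset.Ico_eq_empty_of_le h, Finset.prod_empty]
  · rw [div_self (Real.cosh_pos _).ne', one_mul]

lemma hittingPotential_zero_zero (m : ℕ) :
    hittingPotential c θ m 0 0 = hittingTransform c θ m := by
  rw [hittingPotential_self, hittingTransform, Finset.range_eq_Ico]

/-- Below the maximum this is `cosh (u + θ) + cosh (u - θ) = 2 cosh θ cosh u`. At the maximum,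
solving the equation for the unknown factor gives precisely `hittingFactor`. -/
lemma hittingPotential_step (hc : 0 ≤ c) (hθ : 0 ≤ θ) {m x r : ℕ} (hxr : x ≤ r) (hr : r < m) :
    stepUpProb c x r * hittingPotential c θ m (x + 1) (max r (x + 1))
      + (1 - stepUpProb c x r) * hittingPotential c θ m (x - 1) r
      = Real.cosh θ * hittingPotential c θ m x r := by
  have hcr := (Real.cosh_pos (θ * r)).ne'
  rcases hxr.lt_or_eq with hlt | rfl
  · rw [max_eq_left (Nat.succ_le_of_lt hlt)]
    unfold hittingPotential
    rw [if_neg hr.not_ge, if_neg hr.not_ge, if_neg hr.not_ge]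
    rcases Nat.eq_zero_or_pos x with rfl | hx
    -- At the origin the down-step has weight `0`, so the truncated value `0 - 1 = 0` plays no role.
    · simp [stepUpProb]
      ring
    · rw [stepUpProb, if_neg hx.ne', if_pos hlt]
      have e1 : θ * ((x + 1 : ℕ) : ℝ) = θ * x + θ := by push_cast; ring
      have e2 : θ * ((x - 1 : ℕ) : ℝ) = θ * x - θ := by rw [Nat.cast_pred hx]; ring
      rw [e1, e2, Real.cosh_add, Real.cosh_sub]
      ring
  · rw [max_eq_right (Nat.le_succ x), hittingPotential_self, hittingPotential_self,
      Finset.prod_eq_prod_Ico_succ_bot hr]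
    set Q := ∏ k ∈ Finset.Ico (x + 1) m, (hittingFactor c θ k)⁻¹
    have hf := (hittingFactor_pos hc hθ x).ne'
    rcases Nat.eq_zero_or_pos x with rfl | hx
    · simp only [stepUpProb, if_true, hittingFactor]
      simp [(Real.cosh_pos θ).ne']
    · rw [stepUpProb, if_neg hx.ne', if_neg (lt_irrefl x), hittingPotential, if_neg hr.not_ge,
        Finset.prod_eq_prod_Ico_succ_bot hr]
      have e2 : θ * ((x - 1 : ℕ) : ℝ) = θ * x - θ := by rw [Nat.cast_pred hx]; ring
      have hf2 : hittingFactor c θ x * Real.cosh (θ * x)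
          = Real.cosh θ * Real.cosh (θ * x) + c * Real.sinh θ * Real.sinh (θ * x) := by
        rw [hittingFactor, Real.tanh_eq_sinh_div_cosh]
        field_simp
      have hc1 : 1 + c ≠ 0 := by positivity
      rw [e2, Real.cosh_sub]
      change _ * Q + _ * (_ * (_ * Q)) = _ * (_ * Q)
      field_simp
      linear_combination Q * hf2

end Potential

/-! ### One-step averages of the walk and its running maximum -/

section Walk

variable {Ω : Type*} {mΩ : MeasurableSpace Ω} {P : Measure Ω}
  {ℱ : Filtration ℕ mΩ} {c : ℝ} {X : ℕ → Ω → ℕ}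

lemma le_runningMax (X : ℕ → Ω → ℕ) (n : ℕ) (ω : Ω) : X n ω ≤ runningMax X n ω :=
  Finset.le_sup (f := fun k => X k ω) (Finset.self_mem_range_succ n)

lemma runningMax_zero (X : ℕ → Ω → ℕ) (ω : Ω) : runningMax X 0 ω = X 0 ω := by
  simp [runningMax]

lemma runningMax_succ (X : ℕ → Ω → ℕ) (n : ℕ) (ω : Ω) :
    runningMax X (n + 1) ω = max (runningMax X n ω) (X (n + 1) ω) := by
  unfold runningMax
  rw [Finset.range_add_one, Finset.sup_insert, sup_comm]

lemma monotone_runningMax (X : ℕ → Ω → ℕ) (ω : Ω) : Monotone fun n => runningMax X n ω :=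
  monotone_nat_of_le_succ fun n => by rw [runningMax_succ]; exact le_max_left _ _

namespace IsOnceReinforcedWalk

lemma measurable_runningMax_filtration (hX : IsOnceReinforcedWalk P ℱ c X) (n : ℕ) :
    Measurable[ℱ n] (runningMax X n) := by
  have h : ∀ k ≤ n, Measurable[ℱ n] (runningMax X k) := by
    intro k
    induction k with
    | zero =>
      intro hk
      have e : runningMax X 0 = X 0 := funext fun ω => runningMax_zero X ω
      rw [e]
      exact (hX.adapted 0).mono (ℱ.mono hk) le_rfl
    | succ k ih =>
      intro hk
      have e : runningMax X (k + 1) = fun ω => max (runningMax X k ω) (X (k + 1) ω) :=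
        funext fun ω => runningMax_succ X k ω
      rw [e]
      exact (ih (Nat.le_of_succ_le hk)).max ((hX.adapted (k + 1)).mono (ℱ.mono hk) le_rfl)
  exact h n le_rfl

lemma measurable_runningMax (hX : IsOnceReinforcedWalk P ℱ c X) (n : ℕ) :
    Measurable (runningMax X n) :=
  (hX.measurable_runningMax_filtration n).mono (ℱ.le n) le_rfl

lemma measurable_comp_filtration (hX : IsOnceReinforcedWalk P ℱ c X) (n : ℕ) (g : ℕ → ℕ → ℝ) :
    Measurable[ℱ n] fun ω => g (X n ω) (runningMax X n ω) :=
  (measurable_of_countable (fun q : ℕ × ℕ => g q.1 q.2)).comp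
    ((hX.adapted n).prodMk (hX.measurable_runningMax_filtration n))

lemma measurable_comp (hX : IsOnceReinforcedWalk P ℱ c X) (n : ℕ) (g : ℕ → ℕ → ℝ) :
    Measurable fun ω => g (X n ω) (runningMax X n ω) :=
  (hX.measurable_comp_filtration n g).mono (ℱ.le n) le_rfl

lemma integrable_comp [IsProbabilityMeasure P] (hX : IsOnceReinforcedWalk P ℱ c X) (n : ℕ) {g : ℕ → ℕ → ℝ} {C : ℝ}
    (hg : ∀ x r, x ≤ r → |g x r| ≤ C) :
    Integrable (fun ω => g (X n ω) (runningMax X n ω)) P :=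
  Integrable.of_bound (hX.measurable_comp n g).aestronglyMeasurable C
    (Eventually.of_forall fun ω => hg _ _ (le_runningMax X n ω))

lemma integral_mul_condExp_filtration [IsProbabilityMeasure P] (ℱ : Filtration ℕ mΩ) (n : ℕ)
    {A U p : Ω → ℝ} (hA : StronglyMeasurable[ℱ n] A) (hAU : Integrable (A * U) P)
    (hU : Integrable U P) (hp : P[U | ℱ n] =ᵐ[P] p) : ∫ ω, A ω * U ω ∂P = ∫ ω, A ω * p ω ∂P := by
  have h := condExp_mul_of_stronglyMeasurable_left (m := ℱ n) hA hAU hU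
  calc ∫ ω, A ω * U ω ∂P = ∫ ω, (P[A * U | ℱ n]) ω ∂P := (integral_condExp (ℱ.le n)).symm
    _ = ∫ ω, A ω * p ω ∂P := integral_congr_ae <| by
      filter_upwards [h, hp] with ω h1 h2
      rw [h1, Pi.mul_apply, h2]

lemma measurableSet_up (hX : IsOnceReinforcedWalk P ℱ c X) (n : ℕ) :
    MeasurableSet {ω | X (n + 1) ω = X n ω + 1} :=
  measurableSet_eq_fun ((hX.adapted (n + 1)).mono (ℱ.le _) le_rfl)
    (((hX.adapted n).mono (ℱ.le _) le_rfl).add_const 1)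

lemma measurableSet_down (hX : IsOnceReinforcedWalk P ℱ c X) (n : ℕ) :
    MeasurableSet {ω | X (n + 1) ω + 1 = X n ω} :=
  measurableSet_eq_fun (((hX.adapted (n + 1)).mono (ℱ.le _) le_rfl).add_const 1)
    ((hX.adapted n).mono (ℱ.le _) le_rfl)

/-- The two events are disjoint and their conditional probabilities add up to `1`, so together they
have full measure. -/
lemma ae_up_or_down [IsProbabilityMeasure P] (hX : IsOnceReinforcedWalk P ℱ c X) (n : ℕ) :
    ∀ᵐ ω ∂P, X (n + 1) ω = X n ω + 1 ∨ X (n + 1) ω + 1 = X n ω := by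
  set S := {ω | X (n + 1) ω = X n ω + 1}
  set D := {ω | X (n + 1) ω + 1 = X n ω}
  have hS : MeasurableSet S := hX.measurableSet_up n
  have hD : MeasurableSet D := hX.measurableSet_down n
  have hdisj : Disjoint S D := Set.disjoint_left.2 fun ω (h1 : _ = _) (h2 : _ = _) => by omega
  have hcond : ∫ ω, S.indicator (fun _ => (1 : ℝ)) ω + D.indicator (fun _ => (1 : ℝ)) ω ∂P = 1 := by
    have hSi : Integrable (S.indicator fun _ => (1 : ℝ)) P := (integrable_const 1).indicator hS
    have hDi : Integrable (D.indicator fun _ => (1 : ℝ)) P := (integrable_const 1).indicator hD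
    rw [integral_add hSi hDi, ← integral_condExp (ℱ.le n) (f := S.indicator _),
      ← integral_condExp (ℱ.le n) (f := D.indicator _),
      ← integral_add integrable_condExp integrable_condExp]
    rw [integral_congr_ae (g := fun _ => (1 : ℝ))]
    · simp
    · filter_upwards [hX.up n, hX.down n] with ω h1 h2
      rw [h1, h2]
      ring
  have hreal : P.real (S ∪ D) = 1 := by
    rw [measureReal_union hdisj hD, ← hcond, integral_add ((integrable_const 1).indicator hS)
      ((integrable_const 1).indicator hD), integral_indicator_const _ hS,
      integral_indicator_const _ hD]
    simp
  have hone : P (S ∪ D) = 1 := by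
    rw [measureReal_def] at hreal
    rw [← ENNReal.ofReal_toReal (measure_ne_top P (S ∪ D)), hreal, ENNReal.ofReal_one]
  exact (prob_compl_eq_zero_iff (hS.union hD)).2 hone

/-- The pair (position, maximum) is Markov: almost surely it moves to `(x + 1, max r (x + 1))` or
`(x - 1, r)`, and the pre-step factors pull out of the conditional expectation. -/
lemma integral_succ [IsProbabilityMeasure P] (hX : IsOnceReinforcedWalk P ℱ c X) (n : ℕ)
    {g : ℕ → ℕ → ℝ} {C : ℝ} (hg : ∀ x r, x ≤ r → |g x r| ≤ C) :
    ∫ ω, g (X (n + 1) ω) (runningMax X (n + 1) ω) ∂P =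
      ∫ ω, g (X n ω + 1) (max (runningMax X n ω) (X n ω + 1))
          * stepUpProb c (X n ω) (runningMax X n ω)
        + g (X n ω - 1) (runningMax X n ω)
          * (1 - stepUpProb c (X n ω) (runningMax X n ω)) ∂P := by
  set S := {ω | X (n + 1) ω = X n ω + 1}
  set D := {ω | X (n + 1) ω + 1 = X n ω}
  have hS : MeasurableSet S := hX.measurableSet_up n
  have hD : MeasurableSet D := hX.measurableSet_down n
  set A := fun ω => g (X n ω + 1) (max (runningMax X n ω) (X n ω + 1))
  set B := fun ω => g (X n ω - 1) (runningMax X n ω)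
  have hSi : Integrable (S.indicator fun _ => (1 : ℝ)) P := (integrable_const 1).indicator hS
  have hDi : Integrable (D.indicator fun _ => (1 : ℝ)) P := (integrable_const 1).indicator hD
  have hA : Measurable[ℱ n] A := hX.measurable_comp_filtration n fun x r => g (x + 1) (max r (x + 1))
  have hB : Measurable[ℱ n] B := hX.measurable_comp_filtration n fun x r => g (x - 1) r
  have hAC : ∀ ω, ‖A ω‖ ≤ C := fun ω => hg _ _ (le_max_right _ _)
  have hBC : ∀ ω, ‖B ω‖ ≤ C := fun ω => hg _ _ ((Nat.sub_le _ _).trans (le_runningMax X n ω))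
  have hAm : AEStronglyMeasurable A P := (hA.mono (ℱ.le n) le_rfl).aestronglyMeasurable
  have hBm : AEStronglyMeasurable B P := (hB.mono (ℱ.le n) le_rfl).aestronglyMeasurable
  have hAU : Integrable (A * S.indicator fun _ => (1 : ℝ)) P :=
    hSi.bdd_mul hAm (Eventually.of_forall hAC)
  have hBU : Integrable (B * D.indicator fun _ => (1 : ℝ)) P :=
    hDi.bdd_mul hBm (Eventually.of_forall hBC)
  have hup : Integrable (fun ω => stepUpProb c (X n ω) (runningMax X n ω)) P :=
    integrable_condExp.congr (hX.up n)
  have hdn : Integrable (fun ω => 1 - stepUpProb c (X n ω) (runningMax X n ω)) P :=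
    integrable_condExp.congr (hX.down n)
  rw [integral_add (hup.bdd_mul hAm (Eventually.of_forall hAC))
    (hdn.bdd_mul hBm (Eventually.of_forall hBC)),
    ← integral_mul_condExp_filtration ℱ n hA.stronglyMeasurable hAU hSi (hX.up n),
    ← integral_mul_condExp_filtration ℱ n hB.stronglyMeasurable hBU hDi (hX.down n)]
  refine Eq.trans (integral_congr_ae ?_) (integral_add hAU hBU)
  filter_upwards [hX.ae_up_or_down n] with ω hω
  rw [runningMax_succ]
  rcases hω with h | h
  · have h1 : ω ∈ S := h
    have h2 : ω ∉ D := fun h' => by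
      have h'' : X (n + 1) ω + 1 = X n ω := h'
      omega
    simp [h1, h2, A, h]
  · have h1 : ω ∉ S := fun h' => by
      have h'' : X (n + 1) ω = X n ω + 1 := h'
      omega
    have h2 : ω ∈ D := h
    have h3 : X (n + 1) ω = X n ω - 1 := by omega
    have h4 : max (runningMax X n ω) (X (n + 1) ω) = runningMax X n ω :=
      max_eq_left (by have := le_runningMax X n ω; omega)
    rw [h4, h3]
    simp [h1, h2, B]

/-- The generating function of the tail probabilities of the running maximum. -/
theorem hasSum_tail_runningMax [IsProbabilityMeasure P] (hX : IsOnceReinforcedWalk P ℱ c X)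
    (hc : 0 ≤ c) {θ : ℝ} (hθ : 0 < θ) (m : ℕ) :
    HasSum (fun n : ℕ => (1 - (Real.cosh θ)⁻¹) * (Real.cosh θ)⁻¹ ^ n
      * P.real {ω | m ≤ runningMax X n ω}) (hittingTransform c θ m) := by
  set s := (Real.cosh θ)⁻¹ with hs
  have hcosh : 1 < Real.cosh θ := Real.one_lt_cosh.2 hθ.ne'
  have hs0 : 0 < s := inv_pos.2 (Real.cosh_pos θ)
  have hs1 : s < 1 := inv_lt_one_of_one_lt₀ hcosh
  set e : ℕ → ℝ := fun n => ∫ ω, hittingPotential c θ m (X n ω) (runningMax X n ω) ∂P with he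
  have hbd : ∀ x r, x ≤ r → |hittingPotential c θ m x r| ≤ 1 := fun x r h => by
    have := hittingPotential_mem hc hθ.le m h
    rw [abs_of_nonneg this.1]; exact this.2
  have hmem : ∀ n, |e n| ≤ 1 := fun n => by
    have := norm_integral_le_of_norm_le_const (μ := P) (C := 1)
      (f := fun ω => hittingPotential c θ m (X n ω) (runningMax X n ω))
      (Eventually.of_forall fun ω => hbd _ _ (le_runningMax X n ω))
    simpa using this
  have hset : ∀ n, MeasurableSet {ω | m ≤ runningMax X n ω} := fun n =>
    measurableSet_le measurable_const (hX.measurable_runningMax n)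
  -- Where `R_n < m` the discounted potential is preserved on average; where `m ≤ R_n` the potential
  -- stays `1` and discounting loses `1 - s`. Summed with weights `s ^ n`, this telescopes.
  have hstep : ∀ n, s * e (n + 1) = e n - (1 - s) * P.real {ω | m ≤ runningMax X n ω} := by
    intro n
    simp only [he]
    rw [hX.integral_succ n hbd, ← integral_const_mul, ← integral_indicator_one (hset n),
      ← integral_const_mul, ← integral_sub (hX.integrable_comp n hbd)]
    · refine integral_congr_ae (Eventually.of_forall fun ω => ?_)
      by_cases hr : m ≤ runningMax X n ω
      · have h1 : ω ∈ {ω | m ≤ runningMax X n ω} := hr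
        have h2 : m ≤ max (runningMax X n ω) (X n ω + 1) := hr.trans (le_max_left _ _)
        simp [h1, hittingPotential, hr, h2]
      · have h1 : ω ∉ {ω | m ≤ runningMax X n ω} := hr
        have h2 := hittingPotential_step hc hθ.le (le_runningMax X n ω) (not_le.1 hr)
        simp only [Set.indicator_of_notMem h1, mul_zero, sub_zero]
        rw [mul_comm (hittingPotential _ _ _ _ _), mul_comm (hittingPotential _ _ _ _ _), h2, hs,
          inv_mul_cancel_left₀ (Real.cosh_pos θ).ne']
    · exact (((integrable_const (1 : ℝ)).indicator (hset n)).const_mul (1 - s))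
  have he0 : e 0 = hittingTransform c θ m := by
    rw [← hittingPotential_zero_zero]
    simp only [he]
    rw [integral_congr_ae (g := fun _ => hittingPotential c θ m 0 0)]
    · simp
    · filter_upwards [hX.start] with ω hω
      rw [runningMax_zero, hω]
  have hnonneg : ∀ n, 0 ≤ (1 - s) * s ^ n * P.real {ω | m ≤ runningMax X n ω} := fun n =>
    mul_nonneg (mul_nonneg (by linarith) (by positivity)) measureReal_nonneg
  rw [hasSum_iff_tendsto_nat_of_nonneg hnonneg, ← he0]
  have hpart : ∀ N, ∑ n ∈ Finset.range N, (1 - s) * s ^ n * P.real {ω | m ≤ runningMax X n ω}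
      = e 0 - s ^ N * e N := by
    intro N
    induction N with
    | zero => simp
    | succ N ih =>
      rw [Finset.sum_range_succ, ih, pow_succ]
      linear_combination s ^ N * hstep N
  simp_rw [hpart]
  have hlim : Tendsto (fun N => s ^ N * e N) atTop (𝓝 0) := by
    refine squeeze_zero_norm (fun N => ?_) (tendsto_pow_atTop_nhds_zero_of_lt_one hs0.le hs1)
    rw [norm_mul, Real.norm_of_nonneg (by positivity)]
    exact mul_le_of_le_one_right (by positivity) (hmem N)
  simpa using hlim.const_sub (e 0)

end IsOnceReinforcedWalk
end Walk

/-! ### Scaling limit of the hitting time transform -/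

section Scaling

lemma half_le_tanh {y : ℝ} (hy : 1 ≤ y) : 1 / 2 ≤ Real.tanh y := by
  rw [Real.tanh_eq_sinh_div_cosh, div_le_div_iff₀ two_pos (Real.cosh_pos y), Real.cosh_eq,
    Real.sinh_eq]
  have h1 : 3 ≤ Real.exp (2 * y) := by
    have := Real.add_one_le_exp (2 * y)
    linarith
  have h2 : Real.exp y = Real.exp (2 * y) * Real.exp (-y) := by
    rw [← Real.exp_add]; ring_nf
  have h3 := Real.exp_pos (-y)
  nlinarith

lemma hittingFactor_le_one_add {c θ : ℝ} (hc : 0 ≤ c) (hθ : 0 ≤ θ) (hθ1 : θ ≤ 1) (k : ℕ) :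
    c * θ * Real.tanh (θ * k) ≤ hittingFactor c θ k - 1 ∧
      hittingFactor c θ k - 1 ≤ c * θ * Real.tanh (θ * k) + (1 + c) * θ ^ 2 := by
  have h1 := abs_le.1 (Real.abs_exp_sub_one_sub_id_le (x := θ) (by rw [abs_of_nonneg hθ]; exact hθ1))
  have h2 := abs_le.1 (Real.abs_exp_sub_one_sub_id_le (x := -θ)
    (by rw [abs_neg, abs_of_nonneg hθ]; exact hθ1))
  have hcosh : Real.cosh θ ≤ 1 + θ ^ 2 := by rw [Real.cosh_eq]; nlinarith
  have hsinh : Real.sinh θ ≤ θ + θ ^ 2 := by rw [Real.sinh_eq]; nlinarith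
  have ht0 := tanh_nonneg_of_nonneg (mul_nonneg hθ (Nat.cast_nonneg k))
  have ht1 := (Real.tanh_lt_one (θ * k)).le
  have hs := Real.self_le_sinh_iff.2 hθ
  have hone := Real.one_le_cosh θ
  unfold hittingFactor
  set τ := Real.tanh (θ * k)
  have hct : 0 ≤ c * τ := mul_nonneg hc ht0
  have hct1 : c * τ ≤ c := mul_le_of_le_one_right hc ht1
  constructor
  · nlinarith [mul_le_mul_of_nonneg_left hs hct]
  · nlinarith [mul_le_mul_of_nonneg_left hsinh hct, mul_le_mul_of_nonneg_right hct1 (sq_nonneg θ)]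

/-- For `w ≥ 1` one has `(w - 1) - (w - 1)² ≤ log w ≤ w - 1`, and here `w - 1` is `c θ tanh (θ k)`
up to `O(θ²)` and at most `(2 c + 1) θ`. -/
lemma abs_log_hittingFactor_sub_le {c θ : ℝ} (hc : 0 ≤ c) (hθ : 0 ≤ θ) (hθ1 : θ ≤ 1) (k : ℕ) :
    |Real.log (hittingFactor c θ k) - c * θ * Real.tanh (θ * k)| ≤ (2 * c + 1) ^ 2 * θ ^ 2 := by
  obtain ⟨h1, h2⟩ := hittingFactor_le_one_add hc hθ hθ1 k
  have hw1 := one_le_hittingFactor hc hθ k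
  have hw0 := hittingFactor_pos hc hθ k
  have ht0 := tanh_nonneg_of_nonneg (mul_nonneg hθ (Nat.cast_nonneg k))
  have ht1 := (Real.tanh_lt_one (θ * k)).le
  set w := hittingFactor c θ k
  set τ := Real.tanh (θ * k)
  have hup := Real.log_le_sub_one_of_pos hw0
  have hlow := Real.one_sub_inv_le_log_of_pos hw0
  have hlow2 : (w - 1) - (w - 1) ^ 2 ≤ 1 - w⁻¹ := by
    have e : 1 - w⁻¹ - ((w - 1) - (w - 1) ^ 2) = (w - 1) ^ 3 / w := by
      field_simp; ring
    have : 0 ≤ (w - 1) ^ 3 / w := div_nonneg (pow_nonneg (by linarith) 3) hw0.le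
    linarith
  have hcθ : 0 ≤ c * θ := mul_nonneg hc hθ
  have hlin : w - 1 ≤ (2 * c + 1) * θ := by
    have e1 : c * θ * τ ≤ c * θ := mul_le_of_le_one_right hcθ ht1
    have e2 : (1 + c) * θ ^ 2 ≤ (1 + c) * θ :=
      mul_le_mul_of_nonneg_left (by nlinarith) (by linarith)
    linarith
  have hsq : (w - 1) ^ 2 ≤ (2 * c + 1) ^ 2 * θ ^ 2 := by
    rw [← mul_pow]
    exact pow_le_pow_left₀ (by linarith) hlin 2
  have hcc : (1 + c) * θ ^ 2 ≤ (2 * c + 1) ^ 2 * θ ^ 2 :=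
    mul_le_mul_of_nonneg_right (by nlinarith) (sq_nonneg θ)
  rw [abs_le]
  constructor <;> linarith

lemma hittingTransform_pos {c θ : ℝ} (hc : 0 ≤ c) (hθ : 0 ≤ θ) (m : ℕ) :
    0 < hittingTransform c θ m :=
  Finset.prod_pos fun k _ => inv_pos.2 (hittingFactor_pos hc hθ k)

lemma hittingTransform_le_one {c θ : ℝ} (hc : 0 ≤ c) (hθ : 0 ≤ θ) (m : ℕ) :
    hittingTransform c θ m ≤ 1 :=
  (prod_inv_hittingFactor_mem hc hθ _).2

/-- For `c = 1` the factor is `cosh (θ (k + 1)) / cosh (θ k)` by the addition formula, and the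
product telescopes. -/
lemma hittingTransform_one (θ : ℝ) (m : ℕ) :
    hittingTransform 1 θ m = (Real.cosh (θ * m))⁻¹ := by
  induction m with
  | zero => simp [hittingTransform]
  | succ m ih =>
    have h := (Real.cosh_pos (θ * m)).ne'
    have e : θ * ((m + 1 : ℕ) : ℝ) = θ * m + θ := by push_cast; ring
    have hstep : Real.cosh (θ * ((m + 1 : ℕ) : ℝ)) = Real.cosh (θ * m) * hittingFactor 1 θ m := by
      rw [e, Real.cosh_add, hittingFactor, Real.tanh_eq_sinh_div_cosh]
      field_simp
    rw [hstep, mul_inv, ← ih]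
    exact Finset.prod_range_succ _ _

lemma log_hittingTransform {c θ : ℝ} (hc : 0 ≤ c) (hθ : 0 ≤ θ) (m : ℕ) :
    Real.log (hittingTransform c θ m)
      = -∑ k ∈ Finset.range m, Real.log (hittingFactor c θ k) := by
  unfold hittingTransform
  rw [Real.log_prod fun k _ => (inv_pos.2 (hittingFactor_pos hc hθ k)).ne']
  simp [Real.log_inv]

/-- Comparison with the exact case `c = 1` replaces a Riemann sum estimate: the leading terms `c θ
tanh (θ k)` cancel. The `9` is `(2 * 1 + 1) ^ 2`. -/
lemma abs_log_hittingTransform_add_le {c θ : ℝ} (hc : 0 ≤ c) (hθ : 0 ≤ θ) (hθ1 : θ ≤ 1) (m : ℕ) :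
    |Real.log (hittingTransform c θ m) + c * Real.log (Real.cosh (θ * m))|
      ≤ ((2 * c + 1) ^ 2 + 9 * c) * θ * (θ * m) := by
  have e : Real.log (Real.cosh (θ * m)) = ∑ k ∈ Finset.range m, Real.log (hittingFactor 1 θ k) := by
    have := log_hittingTransform zero_le_one hθ m
    rw [hittingTransform_one, Real.log_inv] at this
    linarith
  rw [log_hittingTransform hc hθ, e, Finset.mul_sum, ← Finset.sum_neg_distrib,
    ← Finset.sum_add_distrib]
  refine (Finset.abs_sum_le_sum_abs _ _).trans ?_
  refine (Finset.sum_le_card_nsmul _ _ (((2 * c + 1) ^ 2 + 9 * c) * θ ^ 2) fun k _ => ?_).trans_eq ?_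
  · have h1 := abs_le.1 (abs_log_hittingFactor_sub_le hc hθ hθ1 k)
    have h2 := abs_le.1 (abs_log_hittingFactor_sub_le zero_le_one hθ hθ1 k)
    have h3 := mul_le_mul_of_nonneg_left h2.1 hc
    have h4 := mul_le_mul_of_nonneg_left h2.2 hc
    rw [abs_le]
    constructor <;> nlinarith
  · rw [Finset.card_range, nsmul_eq_mul]; ring

/-- Supplies a majorant uniform in `θ`. Once `θ m ≥ 2`, `tanh ≥ 1 / 2` makes each factor at least `1
+ 2 δ θ ≥ e^{δ θ}`; before that the exponent is nonnegative, because `θ (m + 1) ≤ 3`. -/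
lemma hittingTransform_le_exp {c θ δ : ℝ} (hc : 0 ≤ c) (hθ : 0 ≤ θ) (hθ1 : θ ≤ 1)
    (hδ : 0 ≤ δ) (hδ1 : δ ≤ 1) (hδc : 4 * δ ≤ c) (m : ℕ) :
    hittingTransform c θ m ≤ Real.exp (-(δ * (θ * m - 3))) := by
  induction m with
  | zero =>
    refine (hittingTransform_le_one hc hθ 0).trans (Real.one_le_exp ?_)
    simp only [Nat.cast_zero, mul_zero, zero_sub]
    linarith
  | succ m ih =>
    rcases lt_or_ge (θ * m) 2 with h | h
    · refine (hittingTransform_le_one hc hθ _).trans (Real.one_le_exp ?_)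
      push_cast
      nlinarith
    · have hf : Real.exp (δ * θ) ≤ hittingFactor c θ m := by
        have h1 := abs_le.1 (Real.abs_exp_sub_one_le (x := δ * θ)
          (by rw [abs_of_nonneg (by positivity)]; exact mul_le_one₀ hδ1 hθ hθ1))
        rw [abs_of_nonneg (by positivity : 0 ≤ δ * θ)] at h1
        have h2 := (hittingFactor_le_one_add hc hθ hθ1 m).1
        have h3 := mul_le_mul_of_nonneg_left (half_le_tanh (by linarith : 1 ≤ θ * m))
          (mul_nonneg hc hθ)
        have h4 := mul_le_mul_of_nonneg_right hδc hθ
        linarith [h1.2]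
      have hinv : (hittingFactor c θ m)⁻¹ ≤ Real.exp (-(δ * θ)) := by
        rw [Real.exp_neg]
        exact inv_anti₀ (Real.exp_pos _) hf
      calc hittingTransform c θ (m + 1)
          = hittingTransform c θ m * (hittingFactor c θ m)⁻¹ := Finset.prod_range_succ _ _
        _ ≤ Real.exp (-(δ * (θ * m - 3))) * Real.exp (-(δ * θ)) :=
            mul_le_mul ih hinv (inv_pos.2 (hittingFactor_pos hc hθ m)).le (Real.exp_pos _).le
        _ = Real.exp (-(δ * (θ * (m + 1 : ℕ) - 3))) := by
            rw [← Real.exp_add]; push_cast; ring_nf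

lemma le_mul_ceil_div {x θ : ℝ} (hθ : 0 < θ) : x ≤ θ * ⌈x / θ⌉₊ := by
  have := Nat.le_ceil (x / θ)
  rwa [div_le_iff₀' hθ] at this

lemma mul_ceil_div_le {x θ : ℝ} (hx : 0 ≤ x) (hθ : 0 < θ) : θ * ⌈x / θ⌉₊ ≤ x + θ := by
  have h := (Nat.ceil_lt_add_one (div_nonneg hx hθ.le)).le
  calc θ * ⌈x / θ⌉₊ ≤ θ * (x / θ + 1) := mul_le_mul_of_nonneg_left h hθ.le
    _ = x + θ := by field_simp

lemma tendsto_mul_ceil_div {x : ℝ} (hx : 0 ≤ x) :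
    Tendsto (fun θ : ℝ => θ * (⌈x / θ⌉₊ : ℝ)) (𝓝[>] 0) (𝓝 x) := by
  have hid : Tendsto (fun θ : ℝ => θ) (𝓝[>] 0) (𝓝 0) := nhdsWithin_le_nhds
  refine tendsto_of_tendsto_of_tendsto_of_le_of_le' tendsto_const_nhds
    (by simpa using hid.const_add x) ?_ ?_
  · filter_upwards [self_mem_nhdsWithin] with θ hθ using le_mul_ceil_div hθ
  · filter_upwards [self_mem_nhdsWithin] with θ hθ using mul_ceil_div_le hx hθ

lemma eventually_mem_Ioc_zero_one : ∀ᶠ θ : ℝ in 𝓝[>] 0, 0 < θ ∧ θ ≤ 1 := by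
  filter_upwards [Ioc_mem_nhdsGT (zero_lt_one (α := ℝ))] with θ hθ using hθ

lemma tendsto_hittingTransform {c x : ℝ} (hc : 0 ≤ c) (hx : 0 ≤ x) :
    Tendsto (fun θ : ℝ => hittingTransform c θ ⌈x / θ⌉₊) (𝓝[>] 0) (𝓝 (Real.cosh x ^ (-c))) := by
  have hid : Tendsto (fun θ : ℝ => θ) (𝓝[>] 0) (𝓝 0) := nhdsWithin_le_nhds
  have hm := tendsto_mul_ceil_div hx
  have herr : Tendsto (fun θ : ℝ => Real.log (hittingTransform c θ ⌈x / θ⌉₊)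
      + c * Real.log (Real.cosh (θ * ⌈x / θ⌉₊))) (𝓝[>] 0) (𝓝 0) := by
    have hb : Tendsto (fun θ : ℝ => ((2 * c + 1) ^ 2 + 9 * c) * θ * (θ * (⌈x / θ⌉₊ : ℝ)))
        (𝓝[>] 0) (𝓝 0) := by
      simpa using (hid.const_mul ((2 * c + 1) ^ 2 + 9 * c)).mul hm
    refine squeeze_zero_norm' ?_ hb
    filter_upwards [eventually_mem_Ioc_zero_one] with θ hθ
    exact abs_log_hittingTransform_add_le hc hθ.1.le hθ.2 _
  have hlog : Tendsto (fun θ : ℝ => c * Real.log (Real.cosh (θ * (⌈x / θ⌉₊ : ℝ)))) (𝓝[>] 0)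
      (𝓝 (c * Real.log (Real.cosh x))) :=
    (((Real.continuous_cosh.tendsto x).comp hm).log (Real.cosh_pos x).ne').const_mul c
  have h := (Real.continuous_exp.tendsto _).comp (herr.sub hlog)
  rw [Real.rpow_def_of_pos (Real.cosh_pos x), show Real.log (Real.cosh x) * -c
    = 0 - c * Real.log (Real.cosh x) by ring]
  refine h.congr' ?_
  filter_upwards [eventually_mem_Ioc_zero_one] with θ hθ
  simp only [Function.comp, add_sub_cancel_right]
  exact Real.exp_log (hittingTransform_pos hc hθ.1.le _)

/-! ### Dominated convergence for the rescaled transform -/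

lemma measurable_hittingTransform_ceil (c θ : ℝ) :
    Measurable fun x : ℝ => hittingTransform c θ ⌈x / θ⌉₊ :=
  (measurable_of_countable (hittingTransform c θ)).comp
    (Nat.measurable_ceil.comp (measurable_id.div_const θ))

lemma exists_dominating_rate {c : ℝ} (hc : 0 < c) : ∃ δ : ℝ, 0 < δ ∧ δ ≤ 1 ∧ 4 * δ ≤ c :=
  ⟨min 1 (c / 4), lt_min one_pos (by positivity), min_le_left _ _,
    by linarith [min_le_right 1 (c / 4)]⟩

lemma hittingTransform_ceil_le_exp {c θ δ x : ℝ} (hc : 0 ≤ c) (hθ : 0 < θ) (hθ1 : θ ≤ 1)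
    (hδ : 0 ≤ δ) (hδ1 : δ ≤ 1) (hδc : 4 * δ ≤ c) :
    hittingTransform c θ ⌈x / θ⌉₊ ≤ Real.exp (3 * δ) * Real.exp (-δ * x) := by
  refine (hittingTransform_le_exp hc hθ.le hθ1 hδ hδ1 hδc _).trans ?_
  rw [← Real.exp_add, Real.exp_le_exp]
  nlinarith [mul_le_mul_of_nonneg_left (le_mul_ceil_div (x := x) hθ) hδ]

lemma integrableOn_rpow_mul_exp {p δ : ℝ} (hp : 0 < p) (hδ : 0 < δ) (C : ℝ) :
    IntegrableOn (fun x : ℝ => x ^ (p - 1) * (C * Real.exp (-δ * x))) (Set.Ioi 0) := by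
  have h := integrableOn_rpow_mul_exp_neg_mul_rpow (p := 1) (s := p - 1) (b := δ) (by linarith)
    one_pos hδ
  refine IntegrableOn.congr_fun (h.const_mul C) (fun x _ => ?_) measurableSet_Ioi
  simp only [Real.rpow_one]
  ring

lemma integrableOn_rpow_mul_hittingTransform {c θ p : ℝ} (hc : 0 < c) (hθ : 0 < θ) (hθ1 : θ ≤ 1)
    (hp : 0 < p) :
    IntegrableOn (fun x : ℝ => x ^ (p - 1) * hittingTransform c θ ⌈x / θ⌉₊) (Set.Ioi 0) := by
  obtain ⟨δ, hδ, hδ1, hδc⟩ := exists_dominating_rate hc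
  refine Integrable.mono' (integrableOn_rpow_mul_exp hp hδ (Real.exp (3 * δ)))
    ((measurable_id.pow_const _).mul (measurable_hittingTransform_ceil c θ)).aestronglyMeasurable ?_
  filter_upwards [ae_restrict_mem measurableSet_Ioi] with x hx
  have hx0 : 0 ≤ x ^ (p - 1) := Real.rpow_nonneg (le_of_lt hx) _
  rw [norm_mul, Real.norm_of_nonneg hx0,
    Real.norm_of_nonneg (hittingTransform_pos hc.le hθ.le _).le]
  exact mul_le_mul_of_nonneg_left
    (hittingTransform_ceil_le_exp hc.le hθ hθ1 hδ.le hδ1 hδc) hx0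

lemma tendsto_integral_rpow_mul_hittingTransform {c p : ℝ} (hc : 0 < c) (hp : 0 < p) :
    Tendsto (fun θ : ℝ => ∫ x in Set.Ioi (0 : ℝ), x ^ (p - 1) * hittingTransform c θ ⌈x / θ⌉₊)
      (𝓝[>] 0) (𝓝 (∫ x in Set.Ioi (0 : ℝ), x ^ (p - 1) * Real.cosh x ^ (-c))) := by
  obtain ⟨δ, hδ, hδ1, hδc⟩ := exists_dominating_rate hc
  refine tendsto_integral_filter_of_dominated_convergence _ ?_ ?_
    (integrableOn_rpow_mul_exp hp hδ (Real.exp (3 * δ))) ?_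
  · exact Eventually.of_forall fun θ =>
      ((measurable_id.pow_const _).mul (measurable_hittingTransform_ceil c θ)).aestronglyMeasurable
  · filter_upwards [eventually_mem_Ioc_zero_one] with θ hθ
    filter_upwards [ae_restrict_mem measurableSet_Ioi] with x hx
    have hx0 : 0 ≤ x ^ (p - 1) := Real.rpow_nonneg (le_of_lt hx) _
    rw [norm_mul, Real.norm_of_nonneg hx0,
      Real.norm_of_nonneg (hittingTransform_pos hc.le hθ.1.le _).le]
    exact mul_le_mul_of_nonneg_left
      (hittingTransform_ceil_le_exp hc.le hθ.1 hθ.2 hδ.le hδ1 hδc) hx0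
  · filter_upwards [ae_restrict_mem measurableSet_Ioi] with x hx
    exact (tendsto_hittingTransform hc.le (le_of_lt hx)).const_mul _

lemma integral_rpow_mul_hittingTransform_ceil (c p : ℝ) {θ : ℝ} (hθ : 0 < θ) :
    ∫ y in Set.Ioi (0 : ℝ), y ^ (p - 1) * hittingTransform c θ ⌈y⌉₊
      = (θ ^ p)⁻¹ * ∫ x in Set.Ioi (0 : ℝ), x ^ (p - 1) * hittingTransform c θ ⌈x / θ⌉₊ := by
  have h := integral_comp_mul_left_Ioi
    (fun x : ℝ => x ^ (p - 1) * hittingTransform c θ ⌈x / θ⌉₊) 0 hθ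
  rw [mul_zero, smul_eq_mul, inv_mul_eq_div, eq_div_iff hθ.ne'] at h
  rw [← h, mul_comm _ θ, ← mul_assoc, ← integral_const_mul]
  refine setIntegral_congr_fun measurableSet_Ioi fun y hy => ?_
  have hne : θ ^ p ≠ 0 := (Real.rpow_pos_of_pos hθ p).ne'
  simp only [mul_div_cancel_left₀ y hθ.ne']
  rw [Real.mul_rpow hθ.le (le_of_lt hy), Real.rpow_sub_one hθ.ne']
  field_simp

end Scaling

/-! ### Moments of the running maximum -/

section Moments

variable {Ω : Type*} {mΩ : MeasurableSpace Ω} {P : Measure Ω}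
  {ℱ : Filtration ℕ mΩ} {c : ℝ} {X : ℕ → Ω → ℕ}

namespace IsOnceReinforcedWalk

lemma tsum_ofReal_mul_tail [IsProbabilityMeasure P] (hX : IsOnceReinforcedWalk P ℱ c X)
    (hc : 0 ≤ c) {θ : ℝ} (hθ : 0 < θ) (m : ℕ) :
    ∑' n : ℕ, ENNReal.ofReal ((1 - (Real.cosh θ)⁻¹) * (Real.cosh θ)⁻¹ ^ n)
      * P {ω | m ≤ runningMax X n ω} = ENNReal.ofReal (hittingTransform c θ m) := by
  have h := hX.hasSum_tail_runningMax hc hθ m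
  have hs : (Real.cosh θ)⁻¹ ≤ 1 := inv_le_one_of_one_le₀ (Real.one_le_cosh θ)
  have hw : ∀ n : ℕ, 0 ≤ (1 - (Real.cosh θ)⁻¹) * (Real.cosh θ)⁻¹ ^ n := fun n =>
    mul_nonneg (by linarith) (pow_nonneg (inv_pos.2 (Real.cosh_pos θ)).le n)
  rw [← h.tsum_eq, ENNReal.ofReal_tsum_of_nonneg (fun n => mul_nonneg (hw n) measureReal_nonneg)
    h.summable]
  refine tsum_congr fun n => ?_
  rw [ENNReal.ofReal_mul (hw n), ofReal_measureReal]

lemma lintegral_runningMax_rpow (hX : IsOnceReinforcedWalk P ℱ c X) {p : ℝ} (hp : 0 < p) (n : ℕ) :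
    ∫⁻ ω, ENNReal.ofReal ((runningMax X n ω : ℝ) ^ p) ∂P
      = ENNReal.ofReal p * ∫⁻ y in Set.Ioi (0 : ℝ),
        P {ω | ⌈y⌉₊ ≤ runningMax X n ω} * ENNReal.ofReal (y ^ (p - 1)) := by
  rw [lintegral_rpow_eq_lintegral_meas_le_mul P (f := fun ω => (runningMax X n ω : ℝ))
    (Eventually.of_forall fun ω => Nat.cast_nonneg _)
    (measurable_from_nat.comp (hX.measurable_runningMax n)).aemeasurable hp]
  simp_rw [Nat.ceil_le]

/-- Layer cake for each moment, then Tonelli to sum over `n` inside the integral. Working in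
`ENNReal` avoids assuming the moments finite. -/
lemma tsum_ofReal_mul_lintegral [IsProbabilityMeasure P] (hX : IsOnceReinforcedWalk P ℱ c X)
    (hc : 0 < c) {θ p : ℝ} (hθ : 0 < θ) (hθ1 : θ ≤ 1) (hp : 0 < p) :
    ∑' n : ℕ, ENNReal.ofReal ((1 - (Real.cosh θ)⁻¹) * (Real.cosh θ)⁻¹ ^ n)
      * ∫⁻ ω, ENNReal.ofReal ((runningMax X n ω : ℝ) ^ p) ∂P
      = ENNReal.ofReal (p * ((θ ^ p)⁻¹ * ∫ x in Set.Ioi (0 : ℝ),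
        x ^ (p - 1) * hittingTransform c θ ⌈x / θ⌉₊)) := by
  have hint : IntegrableOn (fun y : ℝ => y ^ (p - 1) * hittingTransform c θ ⌈y⌉₊) (Set.Ioi 0) := by
    have h := (integrableOn_Ioi_comp_mul_left_iff
      (fun x : ℝ => x ^ (p - 1) * hittingTransform c θ ⌈x / θ⌉₊) 0 hθ).2
      (by rw [mul_zero]; exact integrableOn_rpow_mul_hittingTransform hc hθ hθ1 hp)
    refine IntegrableOn.congr_fun (h.const_mul (θ ^ (p - 1))⁻¹) (fun y hy => ?_) measurableSet_Ioi
    have hne : θ ^ (p - 1) ≠ 0 := (Real.rpow_pos_of_pos hθ _).ne'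
    simp only [mul_div_cancel_left₀ y hθ.ne']
    rw [Real.mul_rpow hθ.le (le_of_lt hy)]
    field_simp
  have hmeas : ∀ n, Measurable fun y : ℝ => P {ω | ⌈y⌉₊ ≤ runningMax X n ω} := fun n =>
    (measurable_of_countable fun m : ℕ => P {ω | m ≤ runningMax X n ω}).comp Nat.measurable_ceil
  have hpow : Measurable fun y : ℝ => ENNReal.ofReal (y ^ (p - 1)) :=
    (measurable_id.pow_const _).ennreal_ofReal
  simp_rw [hX.lintegral_runningMax_rpow hp, mul_left_comm _ (ENNReal.ofReal p)]
  rw [ENNReal.tsum_mul_left, ← integral_rpow_mul_hittingTransform_ceil c p hθ,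
    ENNReal.ofReal_mul hp.le]
  congr 1
  rw [ofReal_integral_eq_lintegral_ofReal hint]
  · refine (tsum_congr fun n => (lintegral_const_mul _ ((hmeas n).mul hpow)).symm).trans ?_
    rw [← lintegral_tsum fun n => (((hmeas n).mul hpow).const_mul _).aemeasurable]
    simp only [Pi.mul_apply]
    refine setLIntegral_congr_fun measurableSet_Ioi fun y hy => ?_
    simp_rw [← mul_assoc]
    rw [ENNReal.tsum_mul_right, hX.tsum_ofReal_mul_tail hc.le hθ,
      ENNReal.ofReal_mul (Real.rpow_nonneg (le_of_lt hy) _), mul_comm]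
  · filter_upwards [ae_restrict_mem measurableSet_Ioi] with y hy
    exact mul_nonneg (Real.rpow_nonneg (le_of_lt hy) _) (hittingTransform_pos hc.le hθ.le _).le

lemma integrable_runningMax_rpow [IsProbabilityMeasure P] (hX : IsOnceReinforcedWalk P ℱ c X)
    (hc : 0 < c) {p : ℝ} (hp : 0 < p) (n : ℕ) :
    Integrable (fun ω => (runningMax X n ω : ℝ) ^ p) P := by
  have hm : Measurable fun ω => (runningMax X n ω : ℝ) ^ p :=
    (measurable_from_nat.comp (hX.measurable_runningMax n)).pow_const p
  rw [← lintegral_ofReal_ne_top_iff_integrable hm.aestronglyMeasurable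
    (Eventually.of_forall fun ω => Real.rpow_nonneg (Nat.cast_nonneg _) _)]
  -- At `θ = 1` the weighted sum of all moments is finite with positive weights, so every single
  -- moment is finite.
  have h := hX.tsum_ofReal_mul_lintegral hc one_pos le_rfl hp
  have hn := ENNReal.ne_top_of_tsum_ne_top (h.trans_ne ENNReal.ofReal_ne_top) n
  intro htop
  rw [htop, ENNReal.mul_top] at hn
  · exact hn rfl
  · rw [Ne, ENNReal.ofReal_eq_zero, not_le]
    exact mul_pos (sub_pos.2 (inv_lt_one_of_one_lt₀ (Real.one_lt_cosh.2 one_ne_zero)))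
      (pow_pos (inv_pos.2 (Real.cosh_pos 1)) n)

lemma hasSum_moment [IsProbabilityMeasure P] (hX : IsOnceReinforcedWalk P ℱ c X)
    (hc : 0 < c) {θ p : ℝ} (hθ : 0 < θ) (hθ1 : θ ≤ 1) (hp : 0 < p) :
    HasSum (fun n : ℕ => (1 - (Real.cosh θ)⁻¹) * (Real.cosh θ)⁻¹ ^ n
      * ∫ ω, (runningMax X n ω : ℝ) ^ p ∂P)
      (p * ((θ ^ p)⁻¹ * ∫ x in Set.Ioi (0 : ℝ),
        x ^ (p - 1) * hittingTransform c θ ⌈x / θ⌉₊)) := by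
  have h := hX.tsum_ofReal_mul_lintegral hc hθ hθ1 hp
  have hs : (Real.cosh θ)⁻¹ ≤ 1 := inv_le_one_of_one_le₀ (Real.one_le_cosh θ)
  have hw : ∀ n : ℕ, 0 ≤ (1 - (Real.cosh θ)⁻¹) * (Real.cosh θ)⁻¹ ^ n := fun n =>
    mul_nonneg (by linarith) (pow_nonneg (inv_pos.2 (Real.cosh_pos θ)).le n)
  have hI : 0 ≤ ∫ x in Set.Ioi (0 : ℝ), x ^ (p - 1) * hittingTransform c θ ⌈x / θ⌉₊ :=
    setIntegral_nonneg measurableSet_Ioi fun x hx =>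
      mul_nonneg (Real.rpow_nonneg (le_of_lt hx) _) (hittingTransform_pos hc.le hθ.le _).le
  have hreal : ∀ n, ∫⁻ ω, ENNReal.ofReal ((runningMax X n ω : ℝ) ^ p) ∂P
      = ENNReal.ofReal (∫ ω, (runningMax X n ω : ℝ) ^ p ∂P) := fun n =>
    (ofReal_integral_eq_lintegral_ofReal (hX.integrable_runningMax_rpow hc hp n)
      (Eventually.of_forall fun ω => Real.rpow_nonneg (Nat.cast_nonneg _) _)).symm
  have hM : ∀ n, 0 ≤ ∫ ω, (runningMax X n ω : ℝ) ^ p ∂P := fun n =>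
    integral_nonneg fun ω => Real.rpow_nonneg (Nat.cast_nonneg _) _
  simp_rw [hreal, ← ENNReal.ofReal_mul (hw _)] at h
  have hsum := ENNReal.hasSum_toReal (h.trans_ne ENNReal.ofReal_ne_top)
  simp_rw [ENNReal.toReal_ofReal (mul_nonneg (hw _) (hM _))] at hsum
  have htot := congrArg ENNReal.toReal h
  rw [ENNReal.tsum_toReal_eq fun n => ENNReal.ofReal_ne_top, ENNReal.toReal_ofReal
    (mul_nonneg hp.le (mul_nonneg (inv_nonneg.2 (Real.rpow_nonneg hθ.le _)) hI))] at htot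
  simp_rw [ENNReal.toReal_ofReal (mul_nonneg (hw _) (hM _))] at htot
  rwa [htot] at hsum

end IsOnceReinforcedWalk

/-! ### The change of variable `e^t = cosh θ` -/

lemma tendsto_arcosh_exp : Tendsto (fun t : ℝ => Real.arcosh (Real.exp t)) (𝓝[>] 0) (𝓝[>] 0) := by
  have hmem : ∀ᶠ t : ℝ in 𝓝[>] 0, 1 < Real.exp t := by
    filter_upwards [self_mem_nhdsWithin] with t ht using Real.one_lt_exp_iff.2 ht
  refine tendsto_nhdsWithin_iff.2 ⟨?_, hmem.mono fun t ht => Real.arcosh_pos ht⟩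
  have h1 : Tendsto Real.arcosh (𝓝[Set.Ici 1] 1) (𝓝 0) := by
    have := Real.continuousOn_arcosh 1 Set.self_mem_Ici
    rwa [ContinuousWithinAt, Real.arcosh_zero] at this
  have h2 : Tendsto Real.exp (𝓝[>] 0) (𝓝[Set.Ici 1] 1) := by
    refine tendsto_nhdsWithin_iff.2 ⟨?_, hmem.mono fun t ht => ht.le⟩
    have := Real.continuous_exp.tendsto 0
    rw [Real.exp_zero] at this
    exact this.mono_left nhdsWithin_le_nhds
  exact h1.comp h2

/-- Squeezed by `1 + θ² / 2 ≤ cosh θ ≤ e^{θ² / 2}`, with `log y ≥ 1 - 1 / y` on the lower side. -/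
lemma tendsto_log_cosh_div_sq :
    Tendsto (fun θ : ℝ => Real.log (Real.cosh θ) / θ ^ 2) (𝓝[>] 0) (𝓝 (1 / 2)) := by
  have hlow : Tendsto (fun θ : ℝ => (1 / 2 : ℝ) / (1 + θ ^ 2 / 2)) (𝓝[>] 0) (𝓝 (1 / 2)) := by
    have hc : ContinuousAt (fun θ : ℝ => (1 / 2 : ℝ) / (1 + θ ^ 2 / 2)) 0 := by
      apply ContinuousAt.div <;> first | fun_prop | norm_num
    have := hc.tendsto
    norm_num at this
    norm_num
    exact this.mono_left nhdsWithin_le_nhds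
  refine tendsto_of_tendsto_of_tendsto_of_le_of_le' hlow tendsto_const_nhds ?_ ?_
  · filter_upwards [self_mem_nhdsWithin] with θ hθ
    have hθ0 : (0 : ℝ) < θ := hθ
    have hcosh : 1 + θ ^ 2 / 2 ≤ Real.cosh θ := by
      have h1 := Real.self_le_sinh_iff.2 (by positivity : 0 ≤ θ / 2)
      have h2 : Real.cosh θ = 1 + 2 * Real.sinh (θ / 2) ^ 2 := by
        have h3 := Real.cosh_two_mul (θ / 2)
        rw [mul_div_cancel₀ θ two_ne_zero, Real.cosh_sq] at h3
        linarith
      nlinarith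
    have hpos : 0 < 1 + θ ^ 2 / 2 := by positivity
    have h4 := Real.one_sub_inv_le_log_of_pos hpos
    have h5 := Real.log_le_log hpos hcosh
    rw [le_div_iff₀ (by positivity)]
    refine le_trans (le_of_eq ?_) (h4.trans h5)
    field_simp
    ring
  · filter_upwards [self_mem_nhdsWithin] with θ hθ
    have hθ0 : (0 : ℝ) < θ := hθ
    rw [div_le_iff₀ (by positivity), Real.log_le_iff_le_exp (Real.cosh_pos θ)]
    exact (Real.cosh_le_exp_half_sq θ).trans_eq (by ring_nf)

lemma tendsto_div_one_sub_exp_neg :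
    Tendsto (fun t : ℝ => t / (1 - Real.exp (-t))) (𝓝[>] 0) (𝓝 1) := by
  have h := tendsto_mul_tsum_exp_neg
  rw [Real.Gamma_one, mul_one] at h
  refine h.congr' ?_
  filter_upwards [self_mem_nhdsWithin] with t ht
  have ht0 : (0 : ℝ) < t := ht
  have e : ∀ n : ℕ, (1 : ℝ) * Real.exp (-(t * n)) = Real.exp (-t) ^ n := fun n => by
    rw [← Real.exp_nat_mul]; ring_nf
  rw [tsum_congr e, tsum_geometric_of_lt_one (Real.exp_pos (-t)).le
    (Real.exp_lt_one_iff.2 (by linarith)), Real.rpow_one, div_eq_mul_inv]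

namespace IsOnceReinforcedWalk

lemma hasSum_moment_exp [IsProbabilityMeasure P] (hX : IsOnceReinforcedWalk P ℱ c X)
    (hc : 0 < c) {p t : ℝ} (ht : 0 < t) (ht1 : Real.arcosh (Real.exp t) ≤ 1) (hp : 0 < p) :
    HasSum (fun n : ℕ => (∫ ω, (runningMax X n ω : ℝ) ^ p ∂P) * Real.exp (-(t * n)))
      ((1 - Real.exp (-t))⁻¹ * (p * ((Real.arcosh (Real.exp t) ^ p)⁻¹ * ∫ x in Set.Ioi (0 : ℝ),
        x ^ (p - 1) * hittingTransform c (Real.arcosh (Real.exp t))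
          ⌈x / Real.arcosh (Real.exp t)⌉₊))) := by
  have hexp : 1 < Real.exp t := Real.one_lt_exp_iff.2 ht
  have h := (hX.hasSum_moment hc (Real.arcosh_pos hexp) ht1 hp).mul_left (1 - Real.exp (-t))⁻¹
  have hne : 1 - Real.exp (-t) ≠ 0 :=
    (sub_pos.2 (Real.exp_lt_one_iff.2 (by linarith : -t < 0))).ne'
  refine h.congr_fun ?_
  intro n
  rw [Real.cosh_arcosh hexp.le, ← Real.exp_neg, mul_assoc, inv_mul_cancel_left₀ hne,
    ← Real.exp_nat_mul, mul_comm]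
  ring_nf

lemma monotone_moment [IsProbabilityMeasure P] (hX : IsOnceReinforcedWalk P ℱ c X)
    (hc : 0 < c) {p : ℝ} (hp : 0 < p) :
    Monotone fun n => ∫ ω, (runningMax X n ω : ℝ) ^ p ∂P := fun _ _ hnm =>
  integral_mono (hX.integrable_runningMax_rpow hc hp _) (hX.integrable_runningMax_rpow hc hp _)
    fun ω => Real.rpow_le_rpow (Nat.cast_nonneg _)
      (Nat.cast_le.2 (monotone_runningMax X ω hnm)) hp.le

/-- The exact formula is available only for `arcosh (e^t) ≤ 1`; for larger `t`, compare with a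
smaller admissible `u ≤ t`. -/
lemma summable_moment_exp [IsProbabilityMeasure P] (hX : IsOnceReinforcedWalk P ℱ c X)
    (hc : 0 < c) {p t : ℝ} (ht : 0 < t) (hp : 0 < p) :
    Summable fun n : ℕ => (∫ ω, (runningMax X n ω : ℝ) ^ p ∂P) * Real.exp (-(t * n)) := by
  have hsmall : ∀ᶠ u : ℝ in 𝓝[>] 0, Real.arcosh (Real.exp u) ≤ 1 :=
    tendsto_arcosh_exp.eventually (eventually_mem_Ioc_zero_one.mono fun θ hθ => hθ.2)
  obtain ⟨u, hu1, hu0, hut⟩ := (hsmall.and (Ioc_mem_nhdsGT ht)).exists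
  refine Summable.of_nonneg_of_le (fun n => mul_nonneg ?_ (Real.exp_pos _).le) (fun n => ?_)
    (hX.hasSum_moment_exp hc hu0 hu1 hp).summable
  · exact integral_nonneg fun ω => Real.rpow_nonneg (Nat.cast_nonneg _) _
  · refine mul_le_mul_of_nonneg_left (Real.exp_le_exp.2 ?_)
      (integral_nonneg fun ω => Real.rpow_nonneg (Nat.cast_nonneg _) _)
    exact neg_le_neg (mul_le_mul_of_nonneg_right hut (Nat.cast_nonneg n))

/-- The `p`-th moment of the running maximum grows like `n ^ (p / 2)`. -/
theorem tendsto_moment [IsProbabilityMeasure P] (hX : IsOnceReinforcedWalk P ℱ c X)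
    (hc : 0 < c) {p : ℝ} (hp : 0 < p) :
    Tendsto (fun n : ℕ => (∫ ω, (runningMax X n ω : ℝ) ^ p ∂P) / (n : ℝ) ^ (p / 2)) atTop
      (𝓝 (2 * (1 / 2 : ℝ) ^ (p / 2) / Real.Gamma (p / 2)
        * ∫ x in Set.Ioi (0 : ℝ), x ^ (p - 1) * Real.cosh x ^ (-c))) := by
  have hp2 : 0 < p / 2 := by positivity
  have hΓ := Real.Gamma_pos_of_pos hp2
  set I := ∫ x in Set.Ioi (0 : ℝ), x ^ (p - 1) * Real.cosh x ^ (-c)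
  have hI : 0 ≤ I := setIntegral_nonneg measurableSet_Ioi fun x hx =>
    mul_nonneg (Real.rpow_nonneg (le_of_lt hx) _) (Real.rpow_nonneg (Real.cosh_pos x).le _)
  refine tendsto_div_rpow_of_tendsto_laplace
    (fun n => integral_nonneg fun ω => Real.rpow_nonneg (Nat.cast_nonneg _) _)
    (hX.monotone_moment hc hp) hp2.le (by positivity)
    (fun t ht => hX.summable_moment_exp hc ht hp) ?_
  have hθ := tendsto_arcosh_exp
  have hratio := (((tendsto_log_cosh_div_sq.comp hθ).rpow_const (p := p / 2)
    (Or.inl (by norm_num))))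
  have hint := (tendsto_integral_rpow_mul_hittingTransform hc hp).comp hθ
  -- The normalization `t ^ (p / 2 + 1)` splits into `t` for the factor `(1 - e^{-t})⁻¹` and `t ^ (p
  -- / 2)` for `θ ^ (-p)`, whose product tends to `(1 / 2) ^ (p / 2)`.
  have h := (tendsto_div_one_sub_exp_neg.mul hratio).mul (hint.const_mul p)
  rw [Real.Gamma_add_one hp2.ne', show 2 * (1 / 2 : ℝ) ^ (p / 2) / Real.Gamma (p / 2) * I
    * (p / 2 * Real.Gamma (p / 2)) = 1 * (1 / 2 : ℝ) ^ (p / 2) * (p * I) by field_simp]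
  refine h.congr' ?_
  filter_upwards [self_mem_nhdsWithin,
    hθ.eventually eventually_mem_Ioc_zero_one] with t ht hθt
  have ht0 : (0 : ℝ) < t := ht
  rw [(hX.hasSum_moment_exp hc ht0 hθt.2 hp).tsum_eq]
  simp only [Function.comp]
  rw [Real.cosh_arcosh (Real.one_le_exp ht0.le), Real.log_exp]
  set θ := Real.arcosh (Real.exp t)
  have hsq : (θ ^ 2) ^ (p / 2) = θ ^ p := by
    rw [← Real.rpow_natCast, ← Real.rpow_mul hθt.1.le]
    congr 1
    push_cast; ring
  rw [Real.div_rpow ht0.le (sq_nonneg θ), hsq, Real.rpow_add ht0, Real.rpow_one]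
  ring

end IsOnceReinforcedWalk

end Moments

/-! ### The limit constant and the main theorem -/

section Constant

variable {c : ℝ} {ℓ : ℕ}

lemma exp_div_exp_two_mul_add_one (x : ℝ) :
    Real.exp x / (Real.exp (2 * x) + 1) = (2 * Real.cosh x)⁻¹ := by
  have h : Real.exp (2 * x) = Real.exp x * Real.exp x := by rw [← Real.exp_add]; ring_nf
  have h0 := (Real.exp_pos x).ne'
  rw [Real.cosh_eq, h, Real.exp_neg]
  field_simp

lemma two_rpow_mul_momentIntegrand (hℓ : 1 ≤ ℓ) (x : ℝ) :
    (2 : ℝ) ^ c * momentIntegrand c ℓ x = x ^ ((ℓ : ℝ) - 1) * Real.cosh x ^ (-c) := by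
  have h2 : (2 : ℝ) ^ c ≠ 0 := (Real.rpow_pos_of_pos two_pos c).ne'
  rw [momentIntegrand, exp_div_exp_two_mul_add_one, Real.inv_rpow
    (mul_nonneg zero_le_two (Real.cosh_pos x).le), Real.mul_rpow zero_le_two (Real.cosh_pos x).le,
    Real.rpow_neg (Real.cosh_pos x).le, ← Nat.cast_pred hℓ, Real.rpow_natCast]
  field_simp

lemma momentConst_eq (hℓ : 1 ≤ ℓ) :
    momentConst c ℓ = ∫ x in Set.Ioi (0 : ℝ), x ^ ((ℓ : ℝ) - 1) * Real.cosh x ^ (-c) := by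
  rw [momentConst, ← integral_const_mul]
  simp_rw [two_rpow_mul_momentIntegrand hℓ]

lemma momentIntegrand_pos {x : ℝ} (hx : 0 < x) : 0 < momentIntegrand c ℓ x :=
  mul_pos (pow_pos hx _) (Real.rpow_pos_of_pos (div_pos (Real.exp_pos _)
    (add_pos (Real.exp_pos _) one_pos)) _)

lemma integrableOn_momentIntegrand (hc : 0 < c) (hℓ : 1 ≤ ℓ) :
    IntegrableOn (momentIntegrand c ℓ) (Set.Ioi 0) := by
  have hℓ0 : (0 : ℝ) < ℓ := Nat.cast_pos.2 hℓ
  refine Integrable.mono' (integrableOn_rpow_mul_exp hℓ0 hc 1) ?_ ?_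
  · have : Measurable (momentIntegrand c ℓ) := by
      unfold momentIntegrand
      fun_prop
    exact this.aestronglyMeasurable
  · filter_upwards [ae_restrict_mem measurableSet_Ioi] with x hx
    rw [Real.norm_of_nonneg (momentIntegrand_pos hx).le, momentIntegrand, ← Nat.cast_pred hℓ,
      Real.rpow_natCast, one_mul]
    refine mul_le_mul_of_nonneg_left ?_ (pow_nonneg (le_of_lt hx) _)
    have h1 : Real.exp x / (Real.exp (2 * x) + 1) ≤ Real.exp (-x) := by
      rw [div_le_iff₀ (add_pos (Real.exp_pos _) one_pos), mul_add, ← Real.exp_add]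
      have : -x + 2 * x = x := by ring
      rw [this]
      linarith [Real.exp_pos (-x)]
    refine (Real.rpow_le_rpow (div_nonneg (Real.exp_pos _).le
      (add_pos (Real.exp_pos _) one_pos).le) h1 hc.le).trans_eq ?_
    rw [← Real.exp_mul]
    ring_nf

lemma momentConst_pos (hc : 0 < c) (hℓ : 1 ≤ ℓ) : 0 < momentConst c ℓ := by
  refine mul_pos (Real.rpow_pos_of_pos two_pos c) ?_
  rw [setIntegral_pos_iff_support_of_nonneg_ae _ (integrableOn_momentIntegrand hc hℓ)]
  · have hsub : Set.Ioi (0 : ℝ) ⊆ Function.support (momentIntegrand c ℓ) := fun x hx =>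
      (momentIntegrand_pos hx).ne'
    rw [Set.inter_eq_right.2 hsub, Real.volume_Ioi]
    exact ENNReal.zero_lt_top
  · filter_upwards [ae_restrict_mem measurableSet_Ioi] with x hx using (momentIntegrand_pos hx).le

lemma two_mul_half_rpow_div_Gamma (p : ℝ) :
    2 * (1 / 2 : ℝ) ^ (p / 2) / Real.Gamma (p / 2)
      = 1 / ((2 : ℝ) ^ ((p - 2) / 2) * Real.Gamma (p / 2)) := by
  have h : (2 : ℝ) ^ (p / 2) ≠ 0 := (Real.rpow_pos_of_pos two_pos _).ne'
  rw [one_div, Real.inv_rpow zero_le_two, show (p - 2) / 2 = p / 2 - 1 by ring,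
    Real.rpow_sub_one two_ne_zero, one_div, mul_inv, inv_div]
  ring

lemma asympEquiv_const_of_tendsto {a : ℕ → ℝ} {L : ℝ} (hL : L ≠ 0) (h : Tendsto a atTop (𝓝 L)) :
    AsympEquiv a fun _ => L := by
  have := h.div_const L
  rwa [div_self hL] at this

lemma div_sqrt_pow (r : ℝ) (n ℓ : ℕ) :
    (r / √(n : ℝ)) ^ ℓ = r ^ (ℓ : ℝ) / (n : ℝ) ^ ((ℓ : ℝ) / 2) := by
  rw [div_pow, Real.rpow_natCast, Real.sqrt_eq_rpow, ← Real.rpow_natCast ((n : ℝ) ^ (1 / 2 : ℝ)),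
    ← Real.rpow_mul (Nat.cast_nonneg n)]
  congr 2
  ring

end Constant

theorem theorem1p1 {Ω : Type*} {mΩ : MeasurableSpace Ω} (P : Measure Ω) [IsProbabilityMeasure P]
    (ℱ : Filtration ℕ mΩ) (c : ℝ) (hc : 0 < c) (X : ℕ → Ω → ℕ)
    (hX : IsOnceReinforcedWalk P ℱ c X) :
    (∀ ℓ : ℕ, 1 ≤ ℓ →
      IntegrableOn (momentIntegrand c ℓ) (Set.Ioi 0) ∧
      (∀ n : ℕ, Integrable (fun ω => ((runningMax X n ω : ℝ) / √(n : ℝ)) ^ ℓ) P) ∧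
      AsympEquiv
        (fun n : ℕ => ∫ ω, ((runningMax X n ω : ℝ) / √(n : ℝ)) ^ ℓ ∂P)
        (fun _ => 1 / ((2 : ℝ) ^ (((ℓ : ℝ) - 2) / 2) * Real.Gamma ((ℓ : ℝ) / 2))
          * momentConst c ℓ)) ∧
    AsympEquiv
      (fun n : ℕ => ∫ ω, (runningMax X n ω : ℝ) / √(n : ℝ) ∂P)
      (fun _ => √(2 / Real.pi) * momentConst c 1) ∧
    AsympEquiv
      (fun n : ℕ => ∫ ω, (runningMax X n ω : ℝ) ^ 2 / (n : ℝ) ∂P)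
      (fun _ => momentConst c 2) := by
  have main : ∀ ℓ : ℕ, 1 ≤ ℓ → AsympEquiv
      (fun n : ℕ => ∫ ω, ((runningMax X n ω : ℝ) / √(n : ℝ)) ^ ℓ ∂P)
      (fun _ => 1 / ((2 : ℝ) ^ (((ℓ : ℝ) - 2) / 2) * Real.Gamma ((ℓ : ℝ) / 2))
        * momentConst c ℓ) := by
    intro ℓ hℓ
    have hℓ0 : (0 : ℝ) < ℓ := Nat.cast_pos.2 hℓ
    have hΓ := Real.Gamma_pos_of_pos (half_pos hℓ0)
    -- Convergence of the ratio to `1` needs a nonzero limit, whence the positivity of the constant.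
    refine asympEquiv_const_of_tendsto
      (mul_pos (one_div_pos.2 (mul_pos (Real.rpow_pos_of_pos two_pos _) hΓ))
        (momentConst_pos hc hℓ)).ne' ?_
    rw [← two_mul_half_rpow_div_Gamma, momentConst_eq hℓ]
    simp_rw [div_sqrt_pow, integral_div]
    exact hX.tendsto_moment hc hℓ0
  refine ⟨fun ℓ hℓ => ⟨integrableOn_momentIntegrand hc hℓ, fun n => ?_, main ℓ hℓ⟩, ?_, ?_⟩
  · simp_rw [div_sqrt_pow]
    exact (hX.integrable_runningMax_rpow hc (Nat.cast_pos.2 hℓ) n).div_const _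
  · have h := main 1 le_rfl
    have hconst : 1 / ((2 : ℝ) ^ ((((1 : ℕ) : ℝ) - 2) / 2) * Real.Gamma (((1 : ℕ) : ℝ) / 2))
        = √(2 / Real.pi) := by
      rw [Nat.cast_one, Real.Gamma_one_half_eq, show ((1 : ℝ) - 2) / 2 = -(1 / 2) by norm_num,
        Real.rpow_neg zero_le_two, ← Real.sqrt_eq_rpow, Real.sqrt_div zero_le_two, one_div, mul_inv,
        inv_inv, div_eq_mul_inv]
    rw [hconst] at h
    simpa only [pow_one] using h
  · have h := main 2 one_le_two
    have hconst : 1 / ((2 : ℝ) ^ ((((2 : ℕ) : ℝ) - 2) / 2) * Real.Gamma (((2 : ℕ) : ℝ) / 2))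
        = 1 := by
      norm_num
    rw [hconst] at h
    simpa only [one_mul, div_pow, Real.sq_sqrt (Nat.cast_nonneg _)] using h
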